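/- Let $G$ be a finite simple undirected graph, not necessarily connected. A path of $G$ is chordless if every edge of $G$ between two of its vertices is an edge of the path. For vertices $u, v$ let $J[u,v]$ be the set of all vertices that lie on a chordless path from $u$ to $v$, and for $X \subseteq V(G)$ let $J[X] = \bigcup_{u,v \in X} J[u,v]$. A set $C \subseteq V(G)$ is monophonically convex if $J[C] = C$. A monophonic half-space is a monophonically convex set $H$ whose complement $V(G) \setminus H$ is monophonically convex too. Each of the following two problems can be decided in polynomial time in the size of the input. (1) Given a graph $G$ and two subsets $A, B$ of $V(G)$, is there a monophonic half-space $H$ of $G$ with $A \subseteq H$ and $B \subseteq V(G) \setminus H$? (2) Given a graph $G$, can $V(G)$ be partitioned into two non-empty monophonically convex sets? -/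

import Mathlib

/-! ### Monophonic convexity -/

namespace SimpleGraph

variable {V : Type*}

/-- The monophonic closed interval `J[u, v]`: all vertices on chordless (that is, induced)
`uv`-paths. -/
def monoInterval (G : SimpleGraph V) (u v : V) : Set V :=
  {w | ∃ p : G.Walk u v, p.IsPath ∧ p.IsChordless ∧ w ∈ p.support}

/-- `J[X]`, the union of the intervals `J[u, v]` with `u, v ∈ X`. -/
def monoIntervalSet (G : SimpleGraph V) (X : Set V) : Set V :=
  ⋃ u ∈ X, ⋃ v ∈ X, G.monoInterval u v

/-- `C` is monophonically convex if `J[C] = C`. -/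
def IsMonoConvex (G : SimpleGraph V) (C : Set V) : Prop :=
  G.monoIntervalSet C = C

/-- A monophonic half-space: a convex set whose complement is convex. -/
def IsMonoHalfSpace (G : SimpleGraph V) (H : Set V) : Prop :=
  G.IsMonoConvex H ∧ G.IsMonoConvex Hᶜ

/-- `A` and `B` are separated by complementary monophonic half-spaces. -/
def MonoSeparable (G : SimpleGraph V) (A B : Set V) : Prop :=
  ∃ H : Set V, G.IsMonoHalfSpace H ∧ A ⊆ H ∧ B ⊆ Hᶜ

/-- The vertex set has a partition into two (non-empty) monophonically convex sets. -/
def HasMonoTwoPartition (G : SimpleGraph V) : Prop :=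
  ∃ C D : Set V, C.Nonempty ∧ D.Nonempty ∧ Disjoint C D ∧ C ∪ D = Set.univ ∧
    G.IsMonoConvex C ∧ G.IsMonoConvex D

end SimpleGraph

/-! ### Random access machines and polynomial time -/

namespace RAM

/-- The instructions of a random access machine with registers and an indirectly addressed memory,
both holding natural numbers. The only arithmetic is addition and (truncated) subtraction, so that
`t` steps can only produce numbers of bit length `O(t + log (input length))`: polynomial time with
one time unit per instruction is the same as polynomial time on Turing machines. -/
inductive Instr : Type
  /-- `reg[r] := c` -/
  | const (r c : ℕ)
  /-- `reg[r] := reg[s]` -/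
  | move (r s : ℕ)
  /-- `reg[r] := reg[s] + reg[t]` -/
  | add (r s t : ℕ)
  /-- `reg[r] := reg[s] - reg[t]`, which is `0` if `reg[s] ≤ reg[t]` -/
  | sub (r s t : ℕ)
  /-- `reg[r] := mem[reg[s]]` -/
  | load (r s : ℕ)
  /-- `mem[reg[r]] := reg[s]` -/
  | store (r s : ℕ)
  /-- continue with the instruction of index `l` -/
  | jump (l : ℕ)
  /-- continue with the instruction of index `l` if `reg[r] = 0`, else with the next one -/
  | jumpZero (r l : ℕ)

/-- A configuration: program counter, registers, memory. -/
structure Config : Type where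
  pc : ℕ
  reg : ℕ → ℕ
  mem : ℕ → ℕ

/-- The effect of one instruction. -/
def Instr.exec (i : Instr) (c : Config) : Config :=
  match i with
  | .const r k => ⟨c.pc + 1, Function.update c.reg r k, c.mem⟩
  | .move r s => ⟨c.pc + 1, Function.update c.reg r (c.reg s), c.mem⟩
  | .add r s t => ⟨c.pc + 1, Function.update c.reg r (c.reg s + c.reg t), c.mem⟩
  | .sub r s t => ⟨c.pc + 1, Function.update c.reg r (c.reg s - c.reg t), c.mem⟩
  | .load r s => ⟨c.pc + 1, Function.update c.reg r (c.mem (c.reg s)), c.mem⟩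
  | .store r s => ⟨c.pc + 1, c.reg, Function.update c.mem (c.reg r) (c.reg s)⟩
  | .jump l => ⟨l, c.reg, c.mem⟩
  | .jumpZero r l => ⟨if c.reg r = 0 then l else c.pc + 1, c.reg, c.mem⟩

/-- A program is a finite list of instructions. -/
abbrev Program : Type := List Instr

/-- The machine has halted when the program counter points past the end of the program. -/
def Halted (P : Program) (c : Config) : Prop :=
  P.length ≤ c.pc

/-- One step of the machine; a halted machine does not move. -/
def step (P : Program) (c : Config) : Config :=
  match P[c.pc]? with
  | some i => i.exec c
  | none => c

/-- The initial configuration on the input word `w`: its letters are stored, as `0` and `1`, in the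
first `|w|` memory cells, and its length in register `0`; everything else is `0`. -/
def init (w : List Bool) : Config where
  pc := 0
  reg := Function.update (fun _ => 0) 0 w.length
  mem := fun a => (w.getD a false).toNat

end RAM

/-- The decision problem `Q`, on instances of type `α` written as binary words by `enc`, is
decidable in polynomial time: some program halts on every instance after a number of steps that is
polynomially bounded in the length of the input word, with a non-zero number in register `0` for
the yes-instances and with `0` in register `0` for the others. -/
def DecidableInPolyTime {α : Type*} (enc : α → List Bool) (Q : α → Prop) : Prop :=
  ∃ (P : RAM.Program) (p : Polynomial ℕ), ∀ x : α, ∃ t ≤ p.eval (enc x).length,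
    RAM.Halted P ((RAM.step P)^[t] (RAM.init (enc x))) ∧
      (((RAM.step P)^[t] (RAM.init (enc x))).reg 0 ≠ 0 ↔ Q x)

/-! ### Inputs and their encodings -/

/-- A finite graph given as an input: its vertices are `0, …, n - 1`. -/
structure GraphInput : Type where
  n : ℕ
  graph : SimpleGraph (Fin n)

/-- A finite graph and two sets of its vertices. -/
structure SeparationInput : Type extends GraphInput where
  A : Set (Fin n)
  B : Set (Fin n)

open Classical in
/-- The characteristic vector of a set of vertices, as `n` bits. -/
noncomputable def encodeVertexSet {n : ℕ} (X : Set (Fin n)) : List Bool :=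
  (List.finRange n).map fun i => decide (i ∈ X)

/-- A graph is written as `n` in unary, `1 ⋯ 1 0`, followed by the rows of its adjacency matrix. -/
noncomputable def GraphInput.encode (I : GraphInput) : List Bool :=
  List.replicate I.n true ++ [false] ++
    (List.finRange I.n).flatMap fun i => encodeVertexSet (I.graph.neighborSet i)

/-- The graph, followed by the characteristic vectors of the two sets. -/
noncomputable def SeparationInput.encode (I : SeparationInput) : List Bool :=
  I.toGraphInput.encode ++ encodeVertexSet I.A ++ encodeVertexSet I.B

/-! A set `H` is a half-space exactly when, within each component, the ends in `H` of the edges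
leaving `H` are pairwise equal or adjacent, and likewise their ends outside `H`
(`isMonoHalfSpace_iff_cutClique`). A chordless path that starts and ends in `H` but leaves it does
so through two distinct nonadjacent vertices of `H`. Conversely, two cut edges of one component are
linked by a chordless path outside `H`, and the path between their ends in `H` obtained by
shortening can only be trivial or a single edge.

Components can be treated separately, and one that misses `A` or `B` goes to one side as a whole. In
any other component, try every edge `ab` as a cut edge with `a` in `H`. The clique condition on
edges `xy` and `x'y'` involves four membership literals, but `ab` reduces it to two. Neighbours of
`a` that are neither `b` nor adjacent to `b` are forced into `H`. Hence if `x` is adjacent to `b`,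
the edge `xy` may be replaced by `xb`, a cut edge as soon as `x` is in `H`; otherwise `x` is forced
into `H`, and `xy` is a cut edge as soon as `y` is outside. Either way one literal per edge is left
(`cutClique_of_not_forbids`). The resulting 2-SAT instance is unsatisfiable exactly when some
literal and its negation imply each other along chains of implications (`TwoSat.satisfiable_iff`).

So separability is expressed by a fixed number of quantifiers over vertices and literals together
with reachability (`SimpleGraph.monoSeparable_iff`). Such statements are written in a small
expression language with sums up to the input length and a reachability operator. Each fixed
expression compiles to a machine program whose running time is polynomial in the input length
(`RAM.Expr.exists_computes`). A partition into two convex sets exists exactly when some two single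
vertices can be separated, which costs two more quantifiers. -/

namespace SimpleGraph

/-! ### Half-spaces and cliques of cut edge ends -/

variable {V : Type*} {G : SimpleGraph V}

/-- A shortest walk inside a vertex set is a chordless path. -/
theorem exists_chordless_path_of_walk {S : Set V} {u v : V} (p : G.Walk u v)
    (hp : ∀ x ∈ p.support, x ∈ S) :
    ∃ q : G.Walk u v, q.IsPath ∧ q.IsChordless ∧ ∀ x ∈ q.support, x ∈ S := by
  classical
  have hex : ∃ k, ∃ q : G.Walk u v, q.length = k ∧ ∀ x ∈ q.support, x ∈ S := ⟨_, p, rfl, hp⟩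
  obtain ⟨q₀, hq₀, hS₀⟩ := Nat.find_spec hex
  have hmin : ∀ r : G.Walk u v, (∀ x ∈ r.support, x ∈ S) → q₀.length ≤ r.length :=
    fun r hr => hq₀ ▸ Nat.find_min' hex ⟨r, rfl, hr⟩
  refine ⟨q₀.bypass, q₀.bypass_isPath, ?_, fun x hx => hS₀ x (q₀.support_bypass_subset_support hx)⟩
  have hS : ∀ x ∈ q₀.bypass.support, x ∈ S := fun x hx => hS₀ x (q₀.support_bypass_subset_support hx)
  have hle := q₀.length_bypass_le_length
  generalize q₀.bypass = q at hS hle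
  -- Replacing the segment `r₂` by a chord `xy` must not shorten the walk, so `r₂` has at most one
  -- edge, and the chord is that edge.
  have key : ∀ x y (r₁ : G.Walk u x) (r₂ : G.Walk x y) (r₃ : G.Walk y v),
      q = r₁.append (r₂.append r₃) → G.Adj x y → s(x, y) ∈ q.edges := by
    intro x y r₁ r₂ r₃ hq hxy
    have h1 := hmin (r₁.append (Walk.cons hxy r₃)) (by
      intro z hz
      apply hS
      rw [hq]
      simp only [Walk.mem_support_append_iff, Walk.support_cons, List.mem_cons] at hz ⊢
      rcases hz with h | rfl | h
      · exact Or.inl h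
      · exact Or.inl r₁.end_mem_support
      · exact Or.inr (Or.inr h))
    have h2 : r₂.length ≤ 1 := by
      subst hq
      simp only [Walk.length_append, Walk.length_cons] at h1 hle
      omega
    have h3 : s(x, y) ∈ r₂.edges := by
      cases r₂ with
      | nil => exact absurd hxy (G.loopless.irrefl _)
      | cons h r =>
        cases r with
        | nil => simp
        | cons h' r' => simp at h2
    rw [hq]
    simp [h3]
  rw [Walk.isChordless_iff_forall_mem_edges]
  intro x y hx hy hxy
  obtain ⟨q₁, q₂, rfl⟩ := Walk.mem_support_iff_exists_append.mp hx
  rcases (Walk.mem_support_append_iff _ _).mp hy with hy | hy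
  · obtain ⟨r₁, r₂, rfl⟩ := Walk.mem_support_iff_exists_append.mp hy
    rw [Sym2.eq_swap]
    exact key y x r₁ r₂ q₂ (by simp [Walk.append_assoc]) hxy.symm
  · obtain ⟨r₁, r₂, rfl⟩ := Walk.mem_support_iff_exists_append.mp hy
    exact key x y q₁ r₁ r₂ rfl hxy

/-- In each component, the end vertices of the cut edges of `H` form a clique on either side. -/
def CutClique (G : SimpleGraph V) (H : Set V) : Prop :=
  ∀ ⦃x y x' y' : V⦄, G.Adj x y → G.Adj x' y' → G.Reachable x x' → x ∈ H → x' ∈ H → y ∉ H →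
    y' ∉ H → (x = x' ∨ G.Adj x x') ∧ (y = y' ∨ G.Adj y y')

theorem CutClique.compl {H : Set V} (h : G.CutClique H) : G.CutClique Hᶜ := by
  intro x y x' y' hxy hx'y' hr hx hx' hy hy'
  have := h hxy.symm hx'y'.symm (hxy.symm.reachable.trans (hr.trans hx'y'.reachable))
    (not_not.mp hy) (not_not.mp hy') hx hx'
  exact this.symm

theorem subset_monoIntervalSet (C : Set V) : C ⊆ G.monoIntervalSet C := fun x hx => by
  simp only [monoIntervalSet, Set.mem_iUnion]
  refine ⟨x, hx, x, hx, Walk.nil, Walk.IsPath.nil, ?_, by simp⟩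
  rw [Walk.isChordless_iff_forall_mem_edges]
  intro u v hu hv huv
  simp only [Walk.support_nil, List.mem_singleton] at hu hv
  subst hu; subst hv
  exact absurd huv (G.loopless.irrefl _)

theorem isMonoConvex_iff {C : Set V} : G.IsMonoConvex C ↔
    ∀ u ∈ C, ∀ v ∈ C, ∀ p : G.Walk u v, p.IsPath → p.IsChordless → ∀ w ∈ p.support, w ∈ C := by
  constructor
  · intro h u hu v hv p hp hc w hw
    rw [← h]
    simp only [monoIntervalSet, Set.mem_iUnion]
    exact ⟨u, hu, v, hv, p, hp, hc, hw⟩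
  · intro h
    refine Set.Subset.antisymm (fun w hw => ?_) (subset_monoIntervalSet C)
    simp only [monoIntervalSet, Set.mem_iUnion] at hw
    obtain ⟨u, hu, v, hv, p, hp, hc, hw⟩ := hw
    exact h u hu v hv p hp hc w hw

/-- If a chordless path between vertices of `H` visits some `w` outside, then an edge leaves `H`
before `w` and, read from the other end, another one after `w`. Their ends in `H` lie strictly on
different sides of `w`, so they are distinct, and adjacency would be a chord. -/
theorem CutClique.isMonoConvex {H : Set V} (h : G.CutClique H) : G.IsMonoConvex H := by
  classical
  rw [isMonoConvex_iff]
  intro u hu v hv p hp hc w hw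
  by_contra hwH
  obtain ⟨q, r, rfl⟩ := Walk.mem_support_iff_exists_append.mp hw
  obtain ⟨d, hd, hd1, hd2⟩ := q.exists_boundary_dart H hu hwH
  obtain ⟨e, he, he1, he2⟩ := r.reverse.exists_boundary_dart H hv hwH
  have hdq : d.fst ∈ q.support := q.dart_fst_mem_support_of_mem_darts hd
  have her : e.fst ∈ r.support := by
    have := r.reverse.dart_fst_mem_support_of_mem_darts he
    simpa using this
  have hdw : d.fst ≠ w := fun h => hwH (h ▸ hd1)
  have hew : e.fst ≠ w := fun h => hwH (h ▸ he1)
  have hdisj : ∀ x, x ∈ q.support → x ∈ r.support → x = w := by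
    intro x hx hx'
    by_contra hxw
    exact hp.ne_of_mem_support_of_append hxw hx hx' rfl
  have hreach : G.Reachable d.fst e.fst :=
    ((q.takeUntil _ hdq).reachable.symm.trans q.reachable).trans
      (r.takeUntil _ her).reachable
  rcases (h d.adj e.adj hreach hd1 he1 hd2 he2).1 with heq | hadj
  · exact hdw (hdisj _ hdq (heq ▸ her))
  -- An edge of the path lies wholly before or wholly after `w`, so one of its ends would lie in
  -- both halves and thus equal `w`.
  · have hmem := hc.mem_edges (by simp [hdq]) (by simp [her]) hadj
    rw [Walk.edges_append, List.mem_append] at hmem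
    rcases hmem with hm | hm
    · exact hew (hdisj _ (q.snd_mem_support_of_mem_edges hm) her)
    · exact hdw (hdisj _ hdq (r.fst_mem_support_of_mem_edges hm))

theorem CutClique.isMonoHalfSpace {H : Set V} (h : G.CutClique H) : G.IsMonoHalfSpace H :=
  ⟨h.isMonoConvex, h.compl.isMonoConvex⟩

/-- Join `y` to `y'` by a chordless path, which stays outside `H`, and extend it to `x` and `x'`. A
chordless path from `x` to `x'` among these vertices stays in `H` by convexity, so it has no
vertices other than `x` and `x'`. -/
theorem eq_or_adj_of_isMonoConvex {H : Set V} (hH : G.IsMonoConvex H) (hHc : G.IsMonoConvex Hᶜ)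
    {x y x' y' : V} (hxy : G.Adj x y) (hx'y' : G.Adj x' y') (hr : G.Reachable x x')
    (hx : x ∈ H) (hx' : x' ∈ H) (hy : y ∉ H) (hy' : y' ∉ H) : x = x' ∨ G.Adj x x' := by
  obtain ⟨p₀⟩ : G.Reachable y y' := hxy.symm.reachable.trans (hr.trans hx'y'.reachable)
  obtain ⟨p, hp, hpc, -⟩ := exists_chordless_path_of_walk (S := Set.univ) p₀ (by simp)
  have hpH := isMonoConvex_iff.mp hHc y hy y' hy' p hp hpc
  obtain ⟨q, hq, hqc, hqS⟩ := exists_chordless_path_of_walk (S := {x, x'} ∪ Hᶜ)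
    (Walk.cons hxy (p.concat hx'y'.symm)) (by
      intro z hz
      simp only [Walk.support_cons, Walk.support_concat, List.mem_cons,
        List.mem_append, List.not_mem_nil, or_false] at hz
      rcases hz with rfl | hz | rfl
      · simp
      · exact Or.inr (hpH z hz)
      · simp)
  have hqH := isMonoConvex_iff.mp hH x hx x' hx' q hq hqc
  have hq2 : ∀ z ∈ q.support, z = x ∨ z = x' := fun z hz => by
    rcases hqS z hz with h | h
    · exact h
    · exact absurd (hqH z hz) h
  cases q with
  | nil => exact Or.inl rfl
  | @cons _ z _ h r =>
    rcases hq2 z (by simp) with rfl | rfl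
    · exact absurd h (G.loopless.irrefl _)
    · exact Or.inr h

theorem isMonoHalfSpace_iff_cutClique {H : Set V} : G.IsMonoHalfSpace H ↔ G.CutClique H := by
  refine ⟨fun h x y x' y' hxy hx'y' hr hx hx' hy hy' => ⟨?_, ?_⟩, CutClique.isMonoHalfSpace⟩
  · exact eq_or_adj_of_isMonoConvex h.1 h.2 hxy hx'y' hr hx hx' hy hy'
  · exact eq_or_adj_of_isMonoConvex h.2 (by simpa using h.1) hxy.symm hx'y'.symm
      (hxy.symm.reachable.trans (hr.trans hx'y'.reachable)) hy hy' (by simpa) (by simpa)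

/-- Separability can be decided in each component on its own. -/
theorem monoSeparable_of_forall_component {A B : Set V}
    (h : ∀ c : G.ConnectedComponent, ∃ H : Set V, G.CutClique H ∧
      (∀ x ∈ A, G.connectedComponentMk x = c → x ∈ H) ∧
      ∀ x ∈ B, G.connectedComponentMk x = c → x ∉ H) : G.MonoSeparable A B := by
  choose H hH hA hB using h
  -- The sets chosen for the components are glued; the clique condition never compares cut edges of
  -- different components.
  refine ⟨{x | x ∈ H (G.connectedComponentMk x)}, isMonoHalfSpace_iff_cutClique.mpr ?_,
    fun x hx => hA _ x hx rfl, fun x hx => hB _ x hx rfl⟩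
  intro x y x' y' hxy hx'y' hr hx hx' hy hy'
  have e1 : G.connectedComponentMk x' = G.connectedComponentMk x :=
    (ConnectedComponent.sound hr).symm
  have e2 : G.connectedComponentMk y = G.connectedComponentMk x :=
    (ConnectedComponent.sound hxy.reachable).symm
  have e3 : G.connectedComponentMk y' = G.connectedComponentMk x :=
    (ConnectedComponent.sound hx'y'.reachable).symm.trans e1
  simp only [Set.mem_ofPred_eq, e1, e2, e3] at hx hx' hy hy'
  exact hH _ hxy hx'y' hr hx hx' hy hy'

/-! ### Two-literal clauses for a guessed cut edge -/

section Clauses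

variable (G) (A B : Set V) (a b : V)

/-- Vertices that are forced into a half-space which contains `a` but not its neighbour `b`, and
contains `A` in the component of `a`. -/
def KnownIn (z : V) : Prop :=
  z = a ∨ (G.Adj z a ∧ ¬ G.Adj z b ∧ z ≠ b) ∨ (z ∈ A ∧ G.Reachable a z)

/-- Literals whose truth is forced. The literal `(z, true)` says that `z` is in the half-space,
`(z, false)` that it is not. -/
def KnownLit (ν : V × Bool) : Prop :=
  if ν.2 then G.KnownIn A a b ν.1 else G.KnownIn B b a ν.1

/-- The literal is one of two given ones or forced. -/
def GrantedBy (l m ν : V × Bool) : Prop :=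
  ν = l ∨ ν = m ∨ G.KnownLit A B a b ν

/-- Two literals cannot both be true: one of them is false anyway, or they produce two cut edges
with a pair of distinct nonadjacent ends on the same side. -/
def Forbids (l m : V × Bool) : Prop :=
  (l = m ∧ G.KnownLit A B a b (l.1, !l.2)) ∨
  ∃ x y x' y', G.Adj x y ∧ G.Adj x' y' ∧
    ((x ≠ x' ∧ ¬ G.Adj x x') ∨ (y ≠ y' ∧ ¬ G.Adj y y')) ∧
    G.GrantedBy A B a b l m (x, true) ∧ G.GrantedBy A B a b l m (x', true) ∧
    G.GrantedBy A B a b l m (y, false) ∧ G.GrantedBy A B a b l m (y', false)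

/-- The literal `l` is true if the half-space is `H`. -/
def LitTrue (H : Set V) (l : V × Bool) : Prop := l.1 ∈ H ↔ l.2 = true

variable {A B a b}

theorem GrantedBy.symm {l m ν : V × Bool} (h : G.GrantedBy A B a b l m ν) :
    G.GrantedBy A B a b m l ν := by
  unfold GrantedBy at *; tauto

theorem Forbids.symm {l m : V × Bool} (h : G.Forbids A B a b l m) : G.Forbids A B a b m l := by
  rcases h with ⟨rfl, h⟩ | ⟨x, y, x', y', h1, h2, h3, h4, h5, h6, h7⟩
  · exact Or.inl ⟨rfl, h⟩
  · exact Or.inr ⟨x, y, x', y', h1, h2, h3, h4.symm, h5.symm, h6.symm, h7.symm⟩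

variable {G}

/-- A neighbour `z` of `a` outside `H` would make `az` a cut edge next to `ab`, so `z` would be `b`
or adjacent to `b`. -/
theorem knownIn_of_cutClique {H : Set V} (hH : G.CutClique H) (hab : G.Adj a b) (ha : a ∈ H)
    (hb : b ∉ H) (hA : A ⊆ H) {z : V} (hz : G.KnownIn A a b z) : z ∈ H := by
  rcases hz with rfl | ⟨h1, h2, h3⟩ | ⟨h, -⟩
  · exact ha
  · by_contra hzH
    rcases (hH hab h1.symm (Reachable.refl _) ha ha hb hzH).2 with h | h
    · exact h3 h.symm
    · exact h2 h.symm
  · exact hA h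

theorem KnownIn.reachable (hab : G.Adj a b) {z : V} (hz : G.KnownIn A a b z) :
    G.Reachable a z := by
  rcases hz with rfl | ⟨h1, -⟩ | ⟨-, h⟩
  · exact Reachable.refl _
  · exact h1.symm.reachable
  · exact h

/-- Soundness of the clauses: a separating half-space that cuts `ab` satisfies all of them. -/
theorem not_forbids_of_cutClique {H : Set V} (hH : G.CutClique H) (hab : G.Adj a b) (ha : a ∈ H)
    (hb : b ∉ H) (hA : A ⊆ H) (hB : B ⊆ Hᶜ) {l m : V × Bool} (h : G.Forbids A B a b l m)
    (hl : LitTrue (H ∩ {x | G.Reachable a x}) l) (hm : LitTrue (H ∩ {x | G.Reachable a x}) m) :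
    False := by
  -- The clauses compare edges without asking whether they lie in one component. Emptying `H`
  -- outside the component of `a` leaves no cut edges elsewhere.
  set K := H ∩ {x | G.Reachable a x}
  have hknown : ∀ ν, G.KnownLit A B a b ν → LitTrue K ν := by
    rintro ⟨z, _ | _⟩ hz
    · simp only [KnownLit, Bool.false_eq_true, if_false] at hz
      have := knownIn_of_cutClique hH.compl hab.symm hb (not_not.mpr ha) hB hz
      simp only [LitTrue, Bool.false_eq_true, iff_false]
      exact fun h => this h.1
    · simp only [KnownLit, if_true] at hz
      simp only [LitTrue, iff_true]
      exact ⟨knownIn_of_cutClique hH hab ha hb hA hz, hz.reachable hab⟩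
  rcases h with ⟨rfl, h⟩ | ⟨x, y, x', y', hxy, hx'y', hbad, h1, h2, h3, h4⟩
  · have := hknown _ h
    obtain ⟨z, _ | _⟩ := l <;> simp_all [LitTrue]
  · have htrue : ∀ ν, G.GrantedBy A B a b l m ν → LitTrue K ν := by
      rintro ν (rfl | rfl | h)
      exacts [hl, hm, hknown _ h]
    have hx : x ∈ K := by simpa [LitTrue] using htrue _ h1
    have hx' : x' ∈ K := by simpa [LitTrue] using htrue _ h2
    have hy : y ∉ K := by simpa [LitTrue] using htrue _ h3
    have hy' : y' ∉ K := by simpa [LitTrue] using htrue _ h4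
    have := hH hxy hx'y' (hx.2.symm.trans hx'.2) hx.1 hx'.1
      (fun h => hy ⟨h, hx.2.trans hxy.reachable⟩) (fun h => hy' ⟨h, hx'.2.trans hx'y'.reachable⟩)
    tauto

/-- The case `l = m` of `Forbids` acts as a unit clause: the negation of a known literal is
forbidden together with itself. -/
theorem litTrue_of_knownLit {H : Set V}
    (h : ∀ l m, G.Forbids A B a b l m → LitTrue H l → LitTrue H m → False) {ν : V × Bool}
    (hν : G.KnownLit A B a b ν) : LitTrue H ν := by
  by_contra hf
  have hneg : LitTrue H (ν.1, !ν.2) := by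
    obtain ⟨z, _ | _⟩ := ν <;> simp_all [LitTrue]
  exact h _ _ (Or.inl ⟨rfl, by simpa using hν⟩) hneg hneg

/-- Completeness of the clauses: each cut edge is exchanged for one that has the same end on the
side under consideration and depends on a single literal, so any violation of the clique condition
is seen by a pair of literals. -/
theorem cutClique_of_not_forbids (hab : G.Adj a b) {H : Set V}
    (h : ∀ l m, G.Forbids A B a b l m → LitTrue H l → LitTrue H m → False) : G.CutClique H := by
  have hin : ∀ z, G.KnownIn A a b z → z ∈ H := fun z hz => by
    simpa [LitTrue] using litTrue_of_knownLit h (ν := (z, true)) (by simpa [KnownLit] using hz)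
  have hout : ∀ z, G.KnownIn B b a z → z ∉ H := fun z hz => by
    simpa [LitTrue] using litTrue_of_knownLit h (ν := (z, false)) (by simpa [KnownLit] using hz)
  have hka : G.KnownLit A B a b (a, true) := by simp [KnownLit, KnownIn]
  have hkb : G.KnownLit A B a b (b, false) := by simp [KnownLit, KnownIn]
  have ha : a ∈ H := hin a (Or.inl rfl)
  have hb : b ∉ H := hout b (Or.inl rfl)
  -- Against `ab`, whose ends are known, a cut edge has only its own two literals to contribute.
  have hnear : ∀ x y, G.Adj x y → x ∈ H → y ∉ H → (x = a ∨ G.Adj x a) ∧ (y = b ∨ G.Adj y b) := by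
    intro x y hxy hx hy
    by_contra hcon
    refine h (x, true) (y, false) (Or.inr ⟨x, y, a, b, hxy, hab, by tauto, Or.inl rfl,
      Or.inr (Or.inr hka), Or.inr (Or.inl rfl), Or.inr (Or.inr hkb)⟩) ?_ ?_ <;>
      simp [LitTrue, hx, hy]
  -- one literal suffices to see that `x` has a neighbour on the other side
  have hx_lit : ∀ x y, G.Adj x y → x ∈ H → y ∉ H → ∃ l z, LitTrue H l ∧ G.Adj x z ∧
      ((x, true) = l ∨ G.KnownLit A B a b (x, true)) ∧
      ((z, false) = l ∨ G.KnownLit A B a b (z, false)) := by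
    intro x y hxy hx hy
    -- With `x` adjacent to `b`, use the edge `xb` and the literal of `x`. Otherwise `hnear` makes
    -- `x` equal or adjacent to `a`, so `x` is forced and the literal of `y` suffices.
    by_cases hxb : G.Adj x b
    · exact ⟨(x, true), b, by simp [LitTrue, hx], hxb, Or.inl rfl, Or.inr hkb⟩
    · refine ⟨(y, false), y, by simp [LitTrue, hy], hxy, Or.inr ?_, Or.inl rfl⟩
      simp only [KnownLit, if_true]
      rcases (hnear x y hxy hx hy).1 with rfl | hxa
      · exact absurd hab hxb
      · exact Or.inr (Or.inl ⟨hxa, hxb, fun h => hb (h ▸ hx)⟩)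
  have hy_lit : ∀ x y, G.Adj x y → x ∈ H → y ∉ H → ∃ l z, LitTrue H l ∧ G.Adj z y ∧
      ((z, true) = l ∨ G.KnownLit A B a b (z, true)) ∧
      ((y, false) = l ∨ G.KnownLit A B a b (y, false)) := by
    intro x y hxy hx hy
    by_cases hya : G.Adj y a
    · exact ⟨(y, false), a, by simp [LitTrue, hy], hya.symm, Or.inr hka, Or.inl rfl⟩
    · refine ⟨(x, true), x, by simp [LitTrue, hx], hxy, Or.inl rfl, Or.inr ?_⟩
      simp only [KnownLit, Bool.false_eq_true, if_false]
      rcases (hnear x y hxy hx hy).2 with rfl | hyb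
      · exact absurd hab.symm hya
      · exact Or.inr (Or.inl ⟨hyb, hya, fun h => hy (h ▸ ha)⟩)
  have left : ∀ {l m ν : V × Bool}, (ν = l ∨ G.KnownLit A B a b ν) → G.GrantedBy A B a b l m ν := by
    unfold GrantedBy; tauto
  have right : ∀ {l m ν : V × Bool}, (ν = m ∨ G.KnownLit A B a b ν) →
      G.GrantedBy A B a b l m ν := by
    unfold GrantedBy; tauto
  intro x y x' y' hxy hx'y' _ hx hx' hy hy'
  constructor
  · by_contra hcon
    obtain ⟨l, z, hl, hz, h1, h2⟩ := hx_lit x y hxy hx hy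
    obtain ⟨l', z', hl', hz', h1', h2'⟩ := hx_lit x' y' hx'y' hx' hy'
    exact h l l' (Or.inr ⟨x, z, x', z', hz, hz', Or.inl (by tauto), left h1, right h1', left h2,
      right h2'⟩) hl hl'
  · by_contra hcon
    obtain ⟨l, z, hl, hz, h1, h2⟩ := hy_lit x y hxy hx hy
    obtain ⟨l', z', hl', hz', h1', h2'⟩ := hy_lit x' y' hx'y' hx' hy'
    exact h l l' (Or.inr ⟨z, y, z', y', hz, hz', Or.inr (by tauto), left h1, right h1', left h2,
      right h2'⟩) hl hl'

/-- A walk from `s` to `t` crosses the boundary of the half-space, and the crossing edge serves as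
`ab`. Conversely, the edge found for one pair `s`, `t` serves the whole component, since all members
of `A` and `B` there are known literals. -/
theorem monoSeparable_iff_exists_litTrue {A B : Set V} : G.MonoSeparable A B ↔
    ∀ s ∈ A, ∀ t ∈ B, G.Reachable s t → ∃ a b, G.Adj a b ∧ G.Reachable s a ∧
      ∃ H, ∀ l m, G.Forbids A B a b l m → LitTrue H l → LitTrue H m → False := by
  constructor
  · rintro ⟨H, hH, hA, hB⟩ s hs t ht ⟨p⟩
    rw [isMonoHalfSpace_iff_cutClique] at hH
    classical
    obtain ⟨d, hd, hd1, hd2⟩ := p.exists_boundary_dart H (hA hs) (hB ht)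
    exact ⟨d.fst, d.snd, d.adj, (p.takeUntil _ (p.dart_fst_mem_support_of_mem_darts hd)).reachable,
      _, fun l m h hl hm => not_forbids_of_cutClique hH d.adj hd1 hd2 hA hB h hl hm⟩
  · intro h
    apply monoSeparable_of_forall_component
    intro c
    by_cases hAc : ∃ s ∈ A, G.connectedComponentMk s = c
    · by_cases hBc : ∃ t ∈ B, G.connectedComponentMk t = c
      · obtain ⟨s, hs, hsc⟩ := hAc
        obtain ⟨t, ht, htc⟩ := hBc
        obtain ⟨a, b, hab, hsa, H, hH⟩ :=
          h s hs t ht (ConnectedComponent.exact (hsc.trans htc.symm))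
        refine ⟨H, cutClique_of_not_forbids hab hH, fun x hx hxc => ?_, fun x hx hxc => ?_⟩
        · have hsx : G.Reachable s x := ConnectedComponent.exact (hsc.trans hxc.symm)
          have : G.KnownLit A B a b (x, true) := by
            simp only [KnownLit, if_true]
            exact Or.inr (Or.inr ⟨hx, hsa.symm.trans hsx⟩)
          simpa [LitTrue] using litTrue_of_knownLit hH this
        · have hsx : G.Reachable s x := ConnectedComponent.exact (hsc.trans hxc.symm)
          have : G.KnownLit A B a b (x, false) := by
            simp only [KnownLit, Bool.false_eq_true, if_false]
            exact Or.inr (Or.inr ⟨hx, hab.symm.reachable.trans (hsa.symm.trans hsx)⟩)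
          simpa [LitTrue] using litTrue_of_knownLit hH this
      · refine ⟨Set.univ, ?_, by simp, fun x hx hxc => absurd ⟨x, hx, hxc⟩ hBc⟩
        intro x y x' y' _ _ _ _ _ hy
        exact absurd (Set.mem_univ y) hy
    · refine ⟨∅, ?_, fun x hx hxc => absurd ⟨x, hx, hxc⟩ hAc, by simp⟩
      intro x y x' y' _ _ _ hx
      exact absurd hx (Set.notMem_empty x)

end Clauses

end SimpleGraph

/-! ### 2-satisfiability -/

namespace TwoSat

variable {V : Type*}

/-- The negation of a literal. -/
def neg (l : V × Bool) : V × Bool := (l.1, !l.2)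

@[simp]
theorem neg_neg (l : V × Bool) : neg (neg l) = l := by simp [neg]

/-- The implications of a set of pairs of literals that are not both true. -/
def Implies (F : V × Bool → V × Bool → Prop) (l m : V × Bool) : Prop := F l (neg m)

variable {F : V × Bool → V × Bool → Prop}

/-- By symmetry of `F`, every implication is present together with its contrapositive. -/
theorem contrapose_implies (hF : ∀ l m, F l m → F m l) {l m : V × Bool}
    (h : Relation.ReflTransGen (Implies F) l m) :
    Relation.ReflTransGen (Implies F) (neg m) (neg l) := by
  induction h with
  | refl => exact .refl
  | tail _ h ih => exact .head (by simpa [Implies] using hF _ _ h) ih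

theorem exists_maximal_consistent [Finite V] (F : V × Bool → V × Bool → Prop) :
    ∃ S : Set (V × Bool), Maximal (fun S => (∀ l ∈ S, ∀ m, Implies F l m → m ∈ S) ∧
      ∀ l ∈ S, neg l ∉ S) S := by
  apply Set.Finite.exists_maximal (Set.toFinite _)
  exact ⟨∅, by simp, by simp⟩

/-- A maximal consistent set of literals closed under implication must decide every variable, for
otherwise it could be enlarged by all consequences of an undecided literal; it then is a satisfying
assignment. -/
theorem satisfiable_iff [Finite V] (hF : ∀ l m, F l m → F m l) :
    (∃ H : Set V, ∀ l m, F l m → SimpleGraph.LitTrue H l → SimpleGraph.LitTrue H m → False) ↔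
      ¬ ∃ l, Relation.ReflTransGen (Implies F) l (neg l) ∧
        Relation.ReflTransGen (Implies F) (neg l) l := by
  have hneg : ∀ (H : Set V) l, SimpleGraph.LitTrue H (neg l) ↔ ¬ SimpleGraph.LitTrue H l := by
    rintro H ⟨z, _ | _⟩ <;> simp [SimpleGraph.LitTrue, neg]
  constructor
  · rintro ⟨H, hH⟩ ⟨l, h1, h2⟩
    have hmono : ∀ {l m}, Relation.ReflTransGen (Implies F) l m → SimpleGraph.LitTrue H l →
        SimpleGraph.LitTrue H m := by
      intro l m h hl
      induction h with
      | refl => exact hl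
      | tail _ h ih =>
        by_contra hm
        exact hH _ _ h ih ((hneg _ _).mpr hm)
    by_cases hl : SimpleGraph.LitTrue H l
    · exact (hneg _ _).mp (hmono h1 hl) hl
    · exact hl (hmono h2 ((hneg _ _).mpr hl))
  · intro h
    obtain ⟨S, ⟨hcl, hcons⟩, hmax⟩ := exists_maximal_consistent F
    have hclR : ∀ {l m}, Relation.ReflTransGen (Implies F) l m → l ∈ S → m ∈ S := by
      intro l m h hl
      induction h with
      | refl => exact hl
      | tail _ h ih => exact hcl _ ih _ h
    have hext : ∀ l, l ∉ S → neg l ∉ S → ¬ Relation.ReflTransGen (Implies F) l (neg l) → False := by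
      intro l hl hnl hR
      refine hl (hmax (y := S ∪ {m | Relation.ReflTransGen (Implies F) l m}) ⟨?_, ?_⟩
        Set.subset_union_left (Or.inr .refl))
      · rintro m (hm | hm) k hk
        · exact Or.inl (hcl _ hm _ hk)
        · exact Or.inr (Relation.ReflTransGen.tail hm hk)
      · rintro m (hm | hm) (hm' | hm')
        · exact hcons _ hm hm'
        · exact hnl (hclR (by simpa using contrapose_implies hF hm') hm)
        · exact hnl (hclR (contrapose_implies hF hm) hm')
        · exact hR (Relation.ReflTransGen.trans hm (by simpa using contrapose_implies hF hm'))
    have htotal : ∀ l, l ∈ S ∨ neg l ∈ S := by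
      intro l
      by_contra hcon
      push Not at hcon
      by_cases hR : Relation.ReflTransGen (Implies F) l (neg l)
      · refine hext (neg l) hcon.2 (by simpa using hcon.1) fun hR' => h ⟨l, hR, ?_⟩
        simpa using hR'
      · exact hext l hcon.1 hcon.2 hR
    have hS : ∀ l, SimpleGraph.LitTrue {z | (z, true) ∈ S} l → l ∈ S := by
      rintro ⟨z, _ | _⟩ hl
      · have : (z, true) ∉ S := by simpa [SimpleGraph.LitTrue] using hl
        exact (htotal (z, false)).resolve_right (by simpa [neg] using this)
      · simpa [SimpleGraph.LitTrue] using hl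
    refine ⟨{z | (z, true) ∈ S}, fun l m hlm hl hm => ?_⟩
    exact hcons m (hS m hm) (hcl l (hS l hl) _ (by simpa [Implies] using hlm))

end TwoSat

/-! ### The criteria to be evaluated by machine -/

namespace SimpleGraph

theorem monoSeparable_iff {V : Type*} [Finite V] {G : SimpleGraph V} {A B : Set V} :
    G.MonoSeparable A B ↔
    ∀ s ∈ A, ∀ t ∈ B, G.Reachable s t → ∃ a b, G.Adj a b ∧ G.Reachable s a ∧
      ¬ ∃ l, Relation.ReflTransGen (TwoSat.Implies (G.Forbids A B a b)) l (TwoSat.neg l) ∧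
        Relation.ReflTransGen (TwoSat.Implies (G.Forbids A B a b)) (TwoSat.neg l) l := by
  rw [monoSeparable_iff_exists_litTrue]
  simp only [TwoSat.satisfiable_iff fun _ _ => Forbids.symm G]

/-- One vertex in each part witnesses that both are non-empty. -/
theorem hasMonoTwoPartition_iff {V : Type*} {G : SimpleGraph V} :
    G.HasMonoTwoPartition ↔ ∃ s t, G.MonoSeparable {s} {t} := by
  constructor
  · rintro ⟨C, D, ⟨s, hs⟩, ⟨t, ht⟩, hdisj, hun, hC, hD⟩
    have hDC : D = Cᶜ := (IsCompl.of_eq hdisj.inter_eq hun).compl_eq.symm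
    subst hDC
    exact ⟨s, t, C, ⟨hC, hD⟩, by simpa using hs, by simpa using ht⟩
  · rintro ⟨s, t, H, ⟨h1, h2⟩, hs, ht⟩
    exact ⟨H, Hᶜ, ⟨s, hs rfl⟩, ⟨t, ht rfl⟩, disjoint_compl_right, Set.union_compl_self H, h1, h2⟩

end SimpleGraph

/-! ### Structured programs for random access machines -/

namespace RAM

/-- Registers and memory of a machine. -/
structure Store : Type where
  reg : ℕ → ℕ
  mem : ℕ → ℕ

/-- Instructions that do not jump. -/
def Instr.IsBasic : Instr → Prop
  | .jump _ => False
  | .jumpZero _ _ => False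
  | _ => True

/-- The effect of an instruction on registers and memory. -/
def Instr.act (i : Instr) (σ : Store) : Store :=
  ⟨(i.exec ⟨0, σ.reg, σ.mem⟩).reg, (i.exec ⟨0, σ.reg, σ.mem⟩).mem⟩

/-- Structured programs. -/
inductive Stmt : Type
  | prim (i : Instr)
  | seq (s t : Stmt)
  /-- run `s` if the register is zero and `t` if not -/
  | ifz (r : ℕ) (s t : Stmt)
  /-- repeat `s` while the register is not zero -/
  | loop (r : ℕ) (s : Stmt)

namespace Stmt

/-- The number of instructions of the compiled program. -/
def len : Stmt → ℕ
  | prim _ => 1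
  | seq s t => s.len + t.len
  | ifz _ s t => t.len + s.len + 2
  | loop _ s => s.len + 2

/-- The machine code, to be placed at address `o`. -/
def code : Stmt → ℕ → Program
  | prim i, _ => [i]
  | seq s t, o => s.code o ++ t.code (o + s.len)
  -- The non-zero branch `t` comes first, followed by a jump over `s`; the two extra units in the
  -- addresses are the test and that jump.
  | ifz r s t, o => .jumpZero r (o + 1 + t.len + 1) ::
      (t.code (o + 1) ++ .jump (o + 1 + t.len + 1 + s.len) :: s.code (o + 1 + t.len + 1))
  | loop r s, o => .jumpZero r (o + 1 + s.len + 1) :: (s.code (o + 1) ++ [.jump o])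

theorem length_code (s : Stmt) (o : ℕ) : (s.code o).length = s.len := by
  induction s generalizing o with
  | prim i => rfl
  | seq s t hs ht => simp [code, len, hs, ht]
  | ifz r s t hs ht => simp [code, len, hs, ht]; omega
  | loop r s hs => simp [code, len, hs]

/-- Big-step semantics with the number of machine steps. -/
inductive Runs : Stmt → Store → Store → ℕ → Prop
  | prim {i : Instr} (hi : i.IsBasic) (σ : Store) : Runs (prim i) σ (i.act σ) 1
  | seq {s t : Stmt} {σ σ₁ σ₂ : Store} {m n : ℕ} (h₁ : Runs s σ σ₁ m) (h₂ : Runs t σ₁ σ₂ n) :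
      Runs (seq s t) σ σ₂ (m + n)
  | ifz_zero {r : ℕ} {s t : Stmt} {σ σ₁ : Store} {m : ℕ} (hr : σ.reg r = 0)
      (h : Runs s σ σ₁ m) : Runs (ifz r s t) σ σ₁ (m + 1)
  | ifz_ne {r : ℕ} {s t : Stmt} {σ σ₁ : Store} {m : ℕ} (hr : σ.reg r ≠ 0)
      (h : Runs t σ σ₁ m) : Runs (ifz r s t) σ σ₁ (1 + (m + 1))
  | loop_zero {r : ℕ} {s : Stmt} {σ : Store} (hr : σ.reg r = 0) : Runs (loop r s) σ σ 1
  | loop_ne {r : ℕ} {s : Stmt} {σ σ₁ σ₂ : Store} {m n : ℕ} (hr : σ.reg r ≠ 0)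
      (h₁ : Runs s σ σ₁ m) (h₂ : Runs (loop r s) σ₁ σ₂ n) :
      Runs (loop r s) σ σ₂ (1 + (m + (1 + n)))

end Stmt

/-- The code `C` stands in `P` at address `o`. -/
def CodeAt (P : Program) (o : ℕ) (C : Program) : Prop :=
  ∀ k i, C[k]? = some i → P[o + k]? = some i

theorem CodeAt.head {P : Program} {o : ℕ} {i : Instr} {C : Program} (h : CodeAt P o (i :: C)) :
    P[o]? = some i := h 0 i (by simp)

theorem CodeAt.tail {P : Program} {o : ℕ} {i : Instr} {C : Program} (h : CodeAt P o (i :: C)) :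
    CodeAt P (o + 1) C := fun k j hj => by
  have := h (k + 1) j (by simpa using hj)
  rwa [show o + 1 + k = o + (k + 1) by omega]

theorem CodeAt.left {P : Program} {o : ℕ} {C D : Program} (h : CodeAt P o (C ++ D)) :
    CodeAt P o C := fun k i hi => h k i (by
  obtain ⟨hk, -⟩ := List.getElem?_eq_some_iff.mp hi
  rw [List.getElem?_append_left hk, hi])

theorem CodeAt.right {P : Program} {o : ℕ} {C D : Program} (h : CodeAt P o (C ++ D)) :
    CodeAt P (o + C.length) D := fun k i hi => by
  have := h (C.length + k) i (by rw [List.getElem?_append_right (by omega)]; simpa using hi)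
  rwa [Nat.add_assoc]

theorem step_of_getElem? {P : Program} {c : Config} {i : Instr} (h : P[c.pc]? = some i) :
    step P c = i.exec c := by
  simp [step, h]

theorem Instr.exec_of_isBasic {i : Instr} (hi : i.IsBasic) (o : ℕ) (σ : Store) :
    i.exec ⟨o, σ.reg, σ.mem⟩ = ⟨o + 1, (i.act σ).reg, (i.act σ).mem⟩ := by
  cases i <;> first | rfl | exact hi.elim

/-- `Runs` charges one unit for each basic instruction, test and jump, so its count is exactly the
number of machine steps. The address is generalized because subprograms stand at shifted addresses.
-/
theorem Stmt.Runs.iterate_step {s : Stmt} {σ σ' : Store} {t : ℕ} (h : s.Runs σ σ' t) {P : Program}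
    {o : ℕ} (hP : CodeAt P o (s.code o)) :
    (step P)^[t] ⟨o, σ.reg, σ.mem⟩ = ⟨o + s.len, σ'.reg, σ'.mem⟩ := by
  induction h generalizing o with
  | prim hi σ =>
    rw [Function.iterate_one, step_of_getElem? (i := _) hP.head, Instr.exec_of_isBasic hi]
    rfl
  | @seq s t σ σ₁ σ₂ m n h₁ h₂ ih₁ ih₂ =>
    have hr := hP.right
    rw [length_code] at hr
    rw [Nat.add_comm m n, Function.iterate_add_apply, ih₁ hP.left, ih₂ hr, len, Nat.add_assoc]
  | @ifz_zero r s t σ σ₁ m hr h ih =>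
    have hs := hP.tail.right.tail
    rw [length_code] at hs
    rw [Function.iterate_succ_apply, step_of_getElem? (c := ⟨o, σ.reg, σ.mem⟩) hP.head]
    simp only [Instr.exec, hr, if_true]
    rw [ih hs, len]
    congr 1
    omega
  | @ifz_ne r s t σ σ₁ m hr h ih =>
    have hs := hP.tail.right
    rw [length_code] at hs
    rw [Nat.add_comm 1, Function.iterate_succ_apply,
      step_of_getElem? (c := ⟨o, σ.reg, σ.mem⟩) hP.head]
    simp only [Instr.exec, hr, if_false]
    rw [Function.iterate_succ_apply', ih hP.tail.left, step_of_getElem? hs.head]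
    simp only [Instr.exec, len]
    congr 1
    omega
  | @loop_zero r s σ hr =>
    rw [Function.iterate_one, step_of_getElem? (c := ⟨o, σ.reg, σ.mem⟩) hP.head]
    simp only [Instr.exec, hr, if_true, len]
    congr 1
    omega
  | @loop_ne r s σ σ₁ σ₂ m n hr h₁ h₂ ih₁ ih₂ =>
    have hs := hP.tail.right
    rw [length_code] at hs
    rw [show 1 + (m + (1 + n)) = (n + 1) + m + 1 by omega, Function.iterate_succ_apply,
      step_of_getElem? (c := ⟨o, σ.reg, σ.mem⟩) hP.head]
    simp only [Instr.exec, hr, if_false]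
    rw [Function.iterate_add_apply, ih₁ hP.tail.left, Function.iterate_succ_apply,
      step_of_getElem? hs.head]
    simp only [Instr.exec]
    rw [ih₂ hP]

namespace Stmt

/-- From `σ`, the program `s` reaches within `T` steps a store with property `Q`. -/
def Ends (s : Stmt) (σ : Store) (T : ℕ) (Q : Store → Prop) : Prop :=
  ∃ σ' t, t ≤ T ∧ s.Runs σ σ' t ∧ Q σ'

theorem Ends.mono {s : Stmt} {σ : Store} {T T' : ℕ} {Q Q' : Store → Prop} (h : s.Ends σ T Q)
    (hT : T ≤ T') (hQ : ∀ σ', Q σ' → Q' σ') : s.Ends σ T' Q' := by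
  obtain ⟨σ', t, ht, hr, hq⟩ := h
  exact ⟨σ', t, ht.trans hT, hr, hQ _ hq⟩

theorem ends_prim {i : Instr} (hi : i.IsBasic) {σ : Store} {Q : Store → Prop} (h : Q (i.act σ)) :
    (prim i).Ends σ 1 Q := ⟨_, 1, le_rfl, .prim hi σ, h⟩

theorem Ends.seq {s t : Stmt} {σ : Store} {m n : ℕ} {Q R : Store → Prop} (h : s.Ends σ m Q)
    (h' : ∀ σ', Q σ' → t.Ends σ' n R) : (s.seq t).Ends σ (m + n) R := by
  obtain ⟨σ₁, a, ha, hr, hq⟩ := h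
  obtain ⟨σ₂, b, hb, hr', hq'⟩ := h' _ hq
  exact ⟨σ₂, a + b, by omega, .seq hr hr', hq'⟩

theorem ends_prim_seq {i : Instr} (hi : i.IsBasic) {t : Stmt} {σ : Store} {n : ℕ}
    {R : Store → Prop} (h : t.Ends (i.act σ) n R) : ((prim i).seq t).Ends σ (1 + n) R :=
  (ends_prim (Q := fun σ' => σ' = i.act σ) hi rfl).seq fun _ h' => h' ▸ h

theorem ends_ifz {r : ℕ} {s t : Stmt} {σ : Store} {m : ℕ} {Q : Store → Prop}
    (h₁ : σ.reg r = 0 → s.Ends σ m Q) (h₂ : σ.reg r ≠ 0 → t.Ends σ m Q) :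
    (ifz r s t).Ends σ (m + 2) Q := by
  by_cases hr : σ.reg r = 0
  · obtain ⟨σ', a, ha, hrun, hq⟩ := h₁ hr
    exact ⟨σ', a + 1, by omega, .ifz_zero hr hrun, hq⟩
  · obtain ⟨σ', a, ha, hrun, hq⟩ := h₂ hr
    exact ⟨σ', 1 + (a + 1), by omega, .ifz_ne hr hrun, hq⟩

/-- A loop whose register counts down to zero. -/
theorem ends_loop {r : ℕ} {s : Stmt} {T : ℕ} (I : ℕ → Store → Prop) (N : ℕ)
    (hI : ∀ i σ, I i σ → σ.reg r = i)
    (hs : ∀ i < N, ∀ σ, I (i + 1) σ → s.Ends σ T (I i)) {σ : Store} (hσ : I N σ) :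
    (loop r s).Ends σ (N * (T + 2) + 1) (I 0) := by
  induction N generalizing σ with
  | zero => exact ⟨σ, 1, by omega, .loop_zero (hI _ _ hσ), hσ⟩
  | succ N ih =>
    obtain ⟨σ₁, a, ha, hrun, hq⟩ := hs N (by omega) σ hσ
    obtain ⟨σ₂, b, hb, hrun', hq'⟩ := ih (fun i hi => hs i (by omega)) hq
    refine ⟨σ₂, _, ?_, .loop_ne (by rw [hI _ _ hσ]; omega) hrun hrun', hq'⟩
    rw [Nat.succ_mul]
    omega

end Stmt

/-! Register `0` holds the length of the input, the odd registers hold variables, the remaining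
ones temporary results. -/

/-- The register of a variable. -/
def varReg (x : ℕ) : ℕ := 2 * x + 1

/-- The registers of temporary results. -/
def tmpReg (d : ℕ) : ℕ := 2 * d + 2

@[simp] theorem varReg_inj {x y : ℕ} : varReg x = varReg y ↔ x = y := by unfold varReg; omega
@[simp] theorem tmpReg_inj {x y : ℕ} : tmpReg x = tmpReg y ↔ x = y := by unfold tmpReg; omega
@[simp] theorem varReg_ne_tmpReg (x d : ℕ) : varReg x ≠ tmpReg d := by
  unfold varReg tmpReg; omega
@[simp] theorem tmpReg_ne_varReg (x d : ℕ) : tmpReg d ≠ varReg x := (varReg_ne_tmpReg x d).symm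
@[simp] theorem zero_ne_varReg (x : ℕ) : 0 ≠ varReg x := by unfold varReg; omega
@[simp] theorem zero_ne_tmpReg (x : ℕ) : 0 ≠ tmpReg x := by unfold tmpReg; omega

/-- The values of the variables. -/
def Store.env (σ : Store) (x : ℕ) : ℕ := σ.reg (varReg x)

/-- The values of the temporary registers. -/
def Store.tmp (σ : Store) (d : ℕ) : ℕ := σ.reg (tmpReg d)

/-- The length of the input. -/
def Store.size (σ : Store) : ℕ := σ.reg 0

/-- The part of the store that is unchanged: the size, the variables, the temporary registers in
`K`, the memory below `a`. -/
structure Frame (K : ℕ → Prop) (a : ℕ) (σ σ' : Store) : Prop where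
  size : σ'.size = σ.size
  env : σ'.env = σ.env
  tmp : ∀ k, K k → σ'.tmp k = σ.tmp k
  mem : ∀ c < a, σ'.mem c = σ.mem c

theorem Frame.refl (K : ℕ → Prop) (a : ℕ) (σ : Store) : Frame K a σ σ :=
  ⟨rfl, rfl, fun _ _ => rfl, fun _ _ => rfl⟩

theorem Frame.trans {K K' K'' : ℕ → Prop} {a a' a'' : ℕ} {σ σ₁ σ₂ : Store}
    (h : Frame K a σ σ₁) (h' : Frame K' a' σ₁ σ₂) (hK : ∀ k, K'' k → K k ∧ K' k)
    (ha : a'' ≤ a) (ha' : a'' ≤ a') : Frame K'' a'' σ σ₂ :=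
  ⟨h'.size.trans h.size, h'.env.trans h.env,
    fun k hk => (h'.tmp k (hK k hk).2).trans (h.tmp k (hK k hk).1),
    fun c hc => (h'.mem c (hc.trans_le ha')).trans (h.mem c (hc.trans_le ha))⟩

theorem Frame.mono {K K' : ℕ → Prop} {a a' : ℕ} {σ σ' : Store} (h : Frame K a σ σ')
    (hK : ∀ k, K' k → K k) (ha : a' ≤ a) : Frame K' a' σ σ' :=
  ⟨h.size, h.env, fun k hk => h.tmp k (hK k hk), fun c hc => h.mem c (hc.trans_le ha)⟩

/-- The store after an assignment to a temporary register. -/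
def Store.setTmp (σ : Store) (d v : ℕ) : Store := ⟨Function.update σ.reg (tmpReg d) v, σ.mem⟩

/-- The store after an assignment to a variable. -/
def Store.setVar (σ : Store) (x v : ℕ) : Store := ⟨Function.update σ.reg (varReg x) v, σ.mem⟩

/-- The store after an assignment to a memory cell. -/
def Store.setMem (σ : Store) (c v : ℕ) : Store := ⟨σ.reg, Function.update σ.mem c v⟩

section simp_lemmas

variable (σ : Store) (d v x c : ℕ)

@[simp] theorem Store.size_setTmp : (σ.setTmp d v).size = σ.size := by simp [setTmp, size]
@[simp] theorem Store.env_setTmp : (σ.setTmp d v).env = σ.env := by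
  funext; simp [setTmp, env]
@[simp] theorem Store.mem_setTmp : (σ.setTmp d v).mem = σ.mem := rfl
@[simp] theorem Store.tmp_setTmp : (σ.setTmp d v).tmp = Function.update σ.tmp d v := by
  funext; simp [setTmp, tmp, Function.update_apply]
@[simp] theorem Store.size_setVar : (σ.setVar x v).size = σ.size := by simp [setVar, size]
@[simp] theorem Store.env_setVar : (σ.setVar x v).env = Function.update σ.env x v := by
  funext; simp [setVar, env, Function.update_apply]
@[simp] theorem Store.mem_setVar : (σ.setVar x v).mem = σ.mem := rfl
@[simp] theorem Store.tmp_setVar : (σ.setVar x v).tmp = σ.tmp := by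
  funext; simp [setVar, tmp]
@[simp] theorem Store.size_setMem : (σ.setMem c v).size = σ.size := rfl
@[simp] theorem Store.env_setMem : (σ.setMem c v).env = σ.env := rfl
@[simp] theorem Store.tmp_setMem : (σ.setMem c v).tmp = σ.tmp := rfl
@[simp] theorem Store.mem_setMem : (σ.setMem c v).mem = Function.update σ.mem c v := rfl

end simp_lemmas

namespace Stmt

/-- Run `s` for each value of the variable `x` from `size - 1` down to `0`. Uses the temporary
registers `d + 1`, `d + 2` and `d + 3`, of which `s` may use the last one. -/
def forVar (d x : ℕ) (s : Stmt) : Stmt :=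
  seq (prim (.move (tmpReg (d + 2)) (varReg x))) <|
  seq (prim (.move (tmpReg (d + 1)) 0)) <|
  seq (loop (tmpReg (d + 1)) <|
    seq (prim (.const (tmpReg (d + 3)) 1)) <|
    seq (prim (.sub (tmpReg (d + 1)) (tmpReg (d + 1)) (tmpReg (d + 3)))) <|
    seq (prim (.move (varReg x) (tmpReg (d + 1)))) s) <|
  prim (.move (varReg x) (tmpReg (d + 2)))

/-- `J i` is the invariant once the values from `size - 1` down to `i` are done; it sees only the
accumulator in register `d` and the memory. The old value of `x` is restored at the end, so the
environment is unchanged. -/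
theorem ends_forVar {d x a T : ℕ} {s : Stmt} {J : ℕ → ℕ → (ℕ → ℕ) → Prop} {σ₀ : Store}
    (h₀ : J σ₀.size (σ₀.tmp d) σ₀.mem)
    (hs : ∀ i < σ₀.size, ∀ σ, σ.size = σ₀.size → σ.env = Function.update σ₀.env x i →
      (∀ k < d, σ.tmp k = σ₀.tmp k) → (∀ c < a, σ.mem c = σ₀.mem c) →
      J (i + 1) (σ.tmp d) σ.mem →
      s.Ends σ T fun σ' => Frame (fun k => k ≠ d ∧ k < d + 3) a σ σ' ∧ J i (σ'.tmp d) σ'.mem) :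
    (forVar d x s).Ends σ₀ (σ₀.size * (T + 5) + 4)
      fun σ' => Frame (· < d) a σ₀ σ' ∧ J 0 (σ'.tmp d) σ'.mem := by
  let I : ℕ → Store → Prop := fun i σ => σ.tmp (d + 1) = i ∧ σ.size = σ₀.size ∧
    (∃ v, σ.env = Function.update σ₀.env x v) ∧ (∀ k < d, σ.tmp k = σ₀.tmp k) ∧
    (∀ c < a, σ.mem c = σ₀.mem c) ∧ σ.tmp (d + 2) = σ₀.env x ∧ J i (σ.tmp d) σ.mem
  have hloop : (loop (tmpReg (d + 1)) <|
      seq (prim (.const (tmpReg (d + 3)) 1)) <|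
      seq (prim (.sub (tmpReg (d + 1)) (tmpReg (d + 1)) (tmpReg (d + 3)))) <|
      seq (prim (.move (varReg x) (tmpReg (d + 1)))) s).Ends
      ((σ₀.setTmp (d + 2) (σ₀.env x)).setTmp (d + 1) σ₀.size) (σ₀.size * (1 + (1 + (1 + T)) + 2) + 1)
      (I 0) := by
    apply ends_loop I
    · intro i σ h
      exact h.1
    · rintro i hi σ ⟨h1, h2, ⟨v, h3⟩, h4, h5, h6, h7⟩
      refine ends_prim_seq (by trivial) ?_
      refine ends_prim_seq (by trivial) ?_
      refine ends_prim_seq (by trivial) ?_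
      have hst : (Instr.move (varReg x) (tmpReg (d + 1))).act
          ((Instr.sub (tmpReg (d + 1)) (tmpReg (d + 1)) (tmpReg (d + 3))).act
            ((Instr.const (tmpReg (d + 3)) 1).act σ)) =
          ((σ.setTmp (d + 3) 1).setTmp (d + 1) i).setVar x i := by
        have h1' : σ.reg (tmpReg (d + 1)) = i + 1 := h1
        simp [Instr.act, Instr.exec, Store.setTmp, Store.setVar, h1']
      rw [hst]
      refine (hs i hi _ (by simp [h2]) (by simp [h3]) ?_ (by simpa using h5) (by simpa)).mono
        le_rfl ?_
      · intro k hk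
        have e1 : k ≠ d + 1 := by omega
        have e2 : k ≠ d + 3 := by omega
        simp [h4 k hk, e1, e2]
      · rintro σ' ⟨hf, hj⟩
        refine ⟨?_, ?_, ⟨i, ?_⟩, ?_, ?_, ?_, hj⟩
        · rw [hf.tmp _ ⟨by omega, by omega⟩]; simp
        · rw [hf.size]; simp [h2]
        · rw [hf.env]; simp [h3]
        · intro k hk
          have e1 : k ≠ d + 1 := by omega
          have e2 : k ≠ d + 3 := by omega
          rw [hf.tmp _ ⟨by omega, by omega⟩]
          simp [h4 k hk, e1, e2]
        · intro c hc
          rw [hf.mem c hc]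
          simpa using h5 c hc
        · rw [hf.tmp _ ⟨by omega, by omega⟩]
          simpa [Function.update_apply] using h6
    · refine ⟨by simp, by simp, ⟨σ₀.env x, by simp⟩, ?_, by simp, by simp, ?_⟩
      · intro k hk
        have e1 : k ≠ d + 1 := by omega
        have e2 : k ≠ d + 2 := by omega
        simp [e1, e2]
      · simpa using h₀
  have hmain : (forVar d x s).Ends σ₀
      (1 + (1 + ((σ₀.size * (1 + (1 + (1 + T)) + 2) + 1) + 1)))
      fun σ' => Frame (· < d) a σ₀ σ' ∧ J 0 (σ'.tmp d) σ'.mem := by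
    refine ends_prim_seq (by trivial) ?_
    refine ends_prim_seq (by trivial) ?_
    have hst : (Instr.move (tmpReg (d + 1)) 0).act
        ((Instr.move (tmpReg (d + 2)) (varReg x)).act σ₀) =
        (σ₀.setTmp (d + 2) (σ₀.env x)).setTmp (d + 1) σ₀.size := by
      simp [Instr.act, Instr.exec, Store.setTmp, Store.env, Store.size]
    rw [hst]
    refine hloop.seq ?_
    rintro σ ⟨h1, h2, ⟨v, h3⟩, h4, h5, h6, h7⟩
    refine ends_prim (by trivial) ?_
    have hst' : (Instr.move (varReg x) (tmpReg (d + 2))).act σ = σ.setVar x (σ₀.env x) := by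
      rw [← h6]
      simp [Instr.act, Instr.exec, Store.setVar, Store.tmp]
    rw [hst']
    exact ⟨⟨by simp [h2], by simp [h3], by simpa using h4, by simpa using h5⟩, by simpa using h7⟩
  -- Each round costs three instructions besides `s` and two steps of loop overhead; the final `4`
  -- counts the two initial moves, the last test and the restoring move.
  refine hmain.mono ?_ fun _ h => h
  have : σ₀.size * (1 + (1 + (1 + T)) + 2) = σ₀.size * (T + 5) := by ring
  omega

end Stmt

end RAM

/-! ### Expressions over the input word, and programs for sums -/

namespace RAM

theorem Frame.setTmp {K : ℕ → Prop} {a d v : ℕ} {σ σ' : Store} (h : Frame K a σ σ')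
    (hd : ¬ K d) : Frame K a σ (σ'.setTmp d v) :=
  ⟨by simp [h.size], by simp [h.env], fun k hk => by
    have : k ≠ d := fun e => hd (e ▸ hk)
    simp [this, h.tmp k hk], by simpa using h.mem⟩

theorem Frame.setMem {K : ℕ → Prop} {a c v : ℕ} {σ σ' : Store} (h : Frame K a σ σ')
    (hc : a ≤ c) : Frame K a σ (σ'.setMem c v) :=
  ⟨by simp [h.size], by simp [h.env], by simpa using h.tmp, fun k hk => by
    have : k ≠ c := by omega
    simp [this, h.mem k hk]⟩

section act

variable (σ : Store) (d e f x k : ℕ)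

@[simp] theorem act_const : (Instr.const (tmpReg d) k).act σ = σ.setTmp d k := rfl
@[simp] theorem act_move_var :
    (Instr.move (tmpReg d) (varReg x)).act σ = σ.setTmp d (σ.env x) := rfl
@[simp] theorem act_add :
    (Instr.add (tmpReg d) (tmpReg e) (tmpReg f)).act σ = σ.setTmp d (σ.tmp e + σ.tmp f) := rfl
@[simp] theorem act_add_var :
    (Instr.add (tmpReg d) (tmpReg e) (varReg x)).act σ = σ.setTmp d (σ.tmp e + σ.env x) := rfl
@[simp] theorem act_add_size :
    (Instr.add (tmpReg d) (tmpReg e) 0).act σ = σ.setTmp d (σ.tmp e + σ.size) := rfl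
@[simp] theorem act_sub :
    (Instr.sub (tmpReg d) (tmpReg e) (tmpReg f)).act σ = σ.setTmp d (σ.tmp e - σ.tmp f) := rfl
@[simp] theorem act_size_sub :
    (Instr.sub (tmpReg d) 0 (tmpReg f)).act σ = σ.setTmp d (σ.size - σ.tmp f) := rfl
@[simp] theorem act_load :
    (Instr.load (tmpReg d) (tmpReg e)).act σ = σ.setTmp d (σ.mem (σ.tmp e)) := rfl
@[simp] theorem act_store :
    (Instr.store (tmpReg d) (tmpReg e)).act σ = σ.setMem (σ.tmp d) (σ.tmp e) := rfl
@[simp] theorem act_move_zero : (Instr.move 0 0).act σ = σ := by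
  simp [Instr.act, Instr.exec]

end act

/-- A language of arithmetic and logical expressions over the input word, with bounded sums and
reachability. Numbers also serve as truth values, with `0` for false. -/
inductive Expr : Type
  | const (k : ℕ)
  | var (x : ℕ)
  | add (a b : Expr)
  | sub (a b : Expr)
  /-- the letter of the input at the given position, `0` if there is none -/
  | inp (a : Expr)
  /-- `a` if `c` is not zero and `b` if it is -/
  | ite (c a b : Expr)
  /-- the sum of `a` over the values of `x` below the length of the input -/
  | sum (x : ℕ) (a : Expr)
  /-- whether some `x` with `a` is joined to some `x` with `c` by steps from `x` to `x + 1`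
  with `b` -/
  | reach (x : ℕ) (a b c : Expr)

namespace Expr

open Classical in
/-- The value of an expression for the input `w` of length `L`. -/
noncomputable def eval (L : ℕ) (w : ℕ → ℕ) : Expr → (ℕ → ℕ) → ℕ
  | const k, _ => k
  | var x, v => v x
  | add a b, v => a.eval L w v + b.eval L w v
  | sub a b, v => a.eval L w v - b.eval L w v
  | inp a, v => if a.eval L w v < L then w (a.eval L w v) else 0
  | ite c a b, v => if c.eval L w v = 0 then b.eval L w v else a.eval L w v
  | sum x a, v => ∑ i ∈ Finset.range L, a.eval L w (Function.update v x i)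
  | reach x a b c, v => if ∃ i < L, ∃ j < L, a.eval L w (Function.update v x i) ≠ 0 ∧
      Relation.ReflTransGen (fun i j => i < L ∧ j < L ∧
        b.eval L w (Function.update (Function.update v x i) (x + 1) j) ≠ 0) i j ∧
      c.eval L w (Function.update v x j) ≠ 0 then 1 else 0

end Expr

namespace Stmt

/-- The program does nothing. -/
def skip : Stmt := prim (.move 0 0)

theorem ends_skip {σ : Store} {Q : Store → Prop} (h : Q σ) : skip.Ends σ 1 Q :=
  ends_prim (by trivial) (by simpa using h)

/-- Put `k` times the size into the temporary register `t`. -/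
def sizeMul (t : ℕ) : ℕ → Stmt
  | 0 => prim (.const (tmpReg t) 0)
  | k + 1 => seq (sizeMul t k) (prim (.add (tmpReg t) (tmpReg t) 0))

theorem ends_sizeMul (t k : ℕ) (σ : Store) :
    (sizeMul t k).Ends σ (k + 1) fun σ' => σ' = σ.setTmp t (σ.size * k) := by
  induction k with
  | zero => exact ends_prim (by trivial) (by simp)
  | succ k ih =>
    refine ih.seq ?_
    rintro σ' rfl
    refine ends_prim (by trivial) ?_
    simp only [act_add_size, Store.tmp_setTmp, Function.update_self, Store.size_setTmp]
    simp [Store.setTmp, Nat.mul_succ]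

/-- Put the address of entry `x` of the `k`-th table into the temporary register `t`. -/
def entry (t k x : ℕ) : Stmt :=
  seq (sizeMul t k) (prim (.add (tmpReg t) (tmpReg t) (varReg x)))

theorem ends_entry_seq {t k x T : ℕ} {s : Stmt} {σ : Store} {Q : Store → Prop}
    (h : s.Ends (σ.setTmp t (σ.size * k + σ.env x)) T Q) :
    ((entry t k x).seq s).Ends σ (k + 2 + T) Q := by
  refine Ends.seq (Q := fun σ' => σ' = σ.setTmp t (σ.size * k + σ.env x)) ?_ fun σ' h' => h' ▸ h
  refine Ends.mono (T := k + 1 + 1) ((ends_sizeMul t k σ).seq ?_) (by omega) fun _ h => h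
  rintro σ' rfl
  refine ends_prim (by trivial) ?_
  simp [Store.setTmp, Store.env, Store.tmp]

/-- On inputs `w` of length `L`, the program `s` puts the value of `f` into the temporary register
`d`; it uses only temporary registers from `d` on and only tables from the `d + 1`-st on. -/
def Computes (L : ℕ) (w : ℕ → ℕ) (s : Stmt) (d : ℕ) (f : (ℕ → ℕ) → ℕ) (T : ℕ) : Prop :=
  ∀ σ : Store, σ.size = L → (∀ c < L, σ.mem c = w c) →
    s.Ends σ T fun σ' => Frame (· < d) (L * (d + 1)) σ σ' ∧ σ'.tmp d = f σ.env

variable {L : ℕ} {w : ℕ → ℕ}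

theorem computes_sum {s : Stmt} {d x T : ℕ} {f : (ℕ → ℕ) → ℕ} (hs : Computes L w s (d + 3) f T) :
    Computes L w (seq (prim (.const (tmpReg d) 0)) (forVar d x (seq s
      (prim (.add (tmpReg d) (tmpReg d) (tmpReg (d + 3))))))) d
      (fun v => ∑ i ∈ Finset.range L, f (Function.update v x i)) (1 + (L * (T + 1 + 5) + 4)) := by
  rintro σ rfl hw
  refine ends_prim_seq (by trivial) ?_
  -- Table `k` starts at address `L * k`, so the input itself occupies table `0` and is never
  -- overwritten.
  have hL : σ.size ≤ σ.size * (d + 1) := Nat.le_mul_of_pos_right _ (by omega)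
  have hL' : σ.size * (d + 1) ≤ σ.size * (d + 3 + 1) := Nat.mul_le_mul_left _ (by omega)
  refine (ends_forVar (a := σ.size * (d + 1)) (T := T + 1) (J := fun i acc _ =>
    acc = ∑ k ∈ Finset.Ico i σ.size, f (Function.update σ.env x k)) (by simp) ?_).mono
      (by simp) ?_
  · intro i hi σ₁ h1 h2 h3 h4 h5
    simp only [act_const, Store.size_setTmp, Store.env_setTmp, Store.mem_setTmp] at h1 h2 h4 hi
    refine (hs σ₁ h1 fun c hc => (h4 c (by omega)).trans (hw c hc)).seq ?_
    rintro σ₂ ⟨hf, hv⟩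
    refine ends_prim (by trivial) ?_
    rw [act_add]
    refine ⟨(hf.mono (fun k hk => hk.2) hL').setTmp (by simp), ?_⟩
    simp only [Store.tmp_setTmp, Function.update_self]
    rw [hf.tmp d (by omega), h5, hv, h2, Finset.sum_eq_sum_Ico_succ_bot hi, Nat.add_comm]
  · rintro σ' ⟨hf, hv⟩
    refine ⟨?_, ?_⟩
    · exact ((Frame.refl (· < d) (σ.size * (d + 1)) σ).setTmp (d := d) (v := 0) (by simp)).trans hf
        (fun k hk => ⟨hk, hk⟩) le_rfl le_rfl
    · exact hv.trans (by rw [Finset.range_eq_Ico])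

/-! ### Reachability by saturating a table of marks -/

section Reach

variable {s₀ s s₁ : Stmt} {d x T₀ T T₁ : ℕ} {f₀ f f₁ : (ℕ → ℕ) → ℕ}

/-- Initialize the `d + 1`-st table. -/
def reachInit (d x : ℕ) (s₀ : Stmt) : Stmt :=
  forVar d x (seq s₀ (seq (entry (d + 4) (d + 1) x) (prim (.store (tmpReg (d + 4)) (tmpReg (d + 3))))))

theorem ends_reachInit (hs : Computes L w s₀ (d + 3) f₀ T₀) {σ : Store} (hL : σ.size = L)
    (hw : ∀ c < L, σ.mem c = w c) :
    (reachInit d x s₀).Ends σ (L * (T₀ + (d + 1 + 2 + 1) + 5) + 4) fun σ' =>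
      Frame (· < d) (L * (d + 1)) σ σ' ∧
        ∀ i < L, σ'.mem (L * (d + 1) + i) = f₀ (Function.update σ.env x i) := by
  subst hL
  have hL : σ.size ≤ σ.size * (d + 1) := Nat.le_mul_of_pos_right _ (by omega)
  have hL' : σ.size * (d + 3 + 1) = σ.size * (d + 1) + 3 * σ.size := by ring
  refine (ends_forVar (a := σ.size * (d + 1)) (T := T₀ + (d + 1 + 2 + 1)) (J := fun i _ m =>
    ∀ k, i ≤ k → k < σ.size → m (σ.size * (d + 1) + k) = f₀ (Function.update σ.env x k))
      (fun k h h' => absurd h (by omega)) ?_).mono le_rfl ?_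
  · intro i hi σ₁ h1 h2 h3 h4 h5
    refine (hs σ₁ h1 fun c hc => (h4 c (by omega)).trans (hw c hc)).seq ?_
    rintro σ₂ ⟨hf, hv⟩
    refine ends_entry_seq (ends_prim (by trivial) ?_)
    rw [act_store]
    refine ⟨((hf.mono (fun k hk => hk.2) (by omega)).setTmp (by simp)).setMem ?_, ?_⟩
    · simp [hf.size, h1]
    · intro k hk hk'
      simp only [Store.tmp_setTmp, Function.update_self, Store.mem_setMem, Store.mem_setTmp,
        hf.size, hf.env, h1, h2, Function.update_apply]
      by_cases hki : k = i
      · subst hki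
        simp [hv, h2]
      · simp [hki]
        rw [hf.mem _ (by omega)]
        exact h5 k (by omega) hk'
  · rintro σ' ⟨hf, hv⟩
    exact ⟨hf, fun i hi => hv i (Nat.zero_le i) hi⟩

/-- Mark the entry `x + 1` of the `d + 1`-st table if the entry `x` is marked and there is a step
from `x` to `x + 1`. -/
def reachStep (d x : ℕ) (s : Stmt) : Stmt :=
  seq (entry (d + 9) (d + 1) x) <| seq (prim (.load (tmpReg (d + 9)) (tmpReg (d + 9)))) <|
    ifz (tmpReg (d + 9)) skip <| seq s <| ifz (tmpReg (d + 9)) skip <|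
      seq (prim (.const (tmpReg (d + 9)) 1)) <| seq (entry (d + 10) (d + 1) (x + 1))
        (prim (.store (tmpReg (d + 10)) (tmpReg (d + 9))))

theorem ends_reachStep (hs : Computes L w s (d + 9) f T) {σ : Store} (hL : σ.size = L)
    (hw : ∀ c < L, σ.mem c = w c) (hx : σ.env x < L) :
    (reachStep d x s).Ends σ (T + 2 * d + 20) fun σ' =>
      Frame (· < d + 9) (L * (d + 1)) σ σ' ∧
        ∀ i < L, σ'.mem (L * (d + 1) + i) ≠ 0 ↔ σ.mem (L * (d + 1) + i) ≠ 0 ∨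
          (i = σ.env (x + 1) ∧ σ.mem (L * (d + 1) + σ.env x) ≠ 0 ∧ f σ.env ≠ 0) := by
  subst hL
  have hL : σ.size ≤ σ.size * (d + 1) := Nat.le_mul_of_pos_right _ (by omega)
  have hL' : σ.size * (d + 9 + 1) = σ.size * (d + 1) + 9 * σ.size := by ring
  have hs' : ∀ σ₁, σ₁ = (σ.setTmp (d + 9) (σ.size * (d + 1) + σ.env x)).setTmp (d + 9)
      (σ.mem (σ.size * (d + 1) + σ.env x)) →
      (ifz (tmpReg (d + 9)) skip <| seq s <| ifz (tmpReg (d + 9)) skip <|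
      seq (prim (.const (tmpReg (d + 9)) 1)) <| seq (entry (d + 10) (d + 1) (x + 1))
        (prim (.store (tmpReg (d + 10)) (tmpReg (d + 9))))).Ends σ₁
        (T + (1 + (d + 1 + 2 + 1) + 2) + 2) fun σ' =>
      Frame (· < d + 9) (σ.size * (d + 1)) σ σ' ∧
        ∀ i < σ.size, σ'.mem (σ.size * (d + 1) + i) ≠ 0 ↔ σ.mem (σ.size * (d + 1) + i) ≠ 0 ∨
          (i = σ.env (x + 1) ∧ σ.mem (σ.size * (d + 1) + σ.env x) ≠ 0 ∧ f σ.env ≠ 0) := by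
    intro σ₁ hσ₁
    have hf₁ : Frame (· < d + 9) (σ.size * (d + 1)) σ σ₁ := by
      rw [hσ₁]
      exact ((Frame.refl _ _ _).setTmp (by simp)).setTmp (by simp)
    have hm₁ : σ₁.mem = σ.mem := by rw [hσ₁]; simp
    have ht₁ : σ₁.reg (tmpReg (d + 9)) = σ.mem (σ.size * (d + 1) + σ.env x) := by
      rw [hσ₁]
      simp [Store.setTmp]
    refine ends_ifz (fun hz => ?_) (fun hz => ?_)
    · refine (ends_skip ⟨hf₁, fun i hi => ?_⟩).mono (by omega) fun _ h => h
      rw [ht₁] at hz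
      simp [hm₁, hz]
    · rw [ht₁] at hz
      refine (hs σ₁ hf₁.size fun c hc => by rw [hm₁]; exact hw c hc).seq ?_
      rintro σ₂ ⟨hf₂, hv⟩
      have hf : Frame (· < d + 9) (σ.size * (d + 1)) σ σ₂ :=
        hf₁.trans hf₂ (fun k hk => ⟨hk, hk⟩) le_rfl (by omega)
      have hm₂ : ∀ i < σ.size, σ₂.mem (σ.size * (d + 1) + i) = σ.mem (σ.size * (d + 1) + i) :=
        fun i hi => by rw [hf₂.mem _ (by omega), hm₁]
      have hv' : σ₂.reg (tmpReg (d + 9)) = f σ.env := by rw [← hf₁.env]; exact hv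
      refine ends_ifz (fun hz' => ?_) (fun hz' => ?_)
      · refine (ends_skip ⟨hf, fun i hi => ?_⟩).mono (by omega) fun _ h => h
        rw [hv'] at hz'
        simp [hm₂ i hi, hz']
      · rw [hv'] at hz'
        refine ends_prim_seq (by trivial) (ends_entry_seq (ends_prim (by trivial) ?_))
        rw [act_store, act_const]
        refine ⟨((hf.setTmp (by simp)).setTmp (by simp)).setMem ?_, fun i hi => ?_⟩
        · simp [hf.size]
        · simp only [Store.tmp_setTmp, Function.update_self, Store.mem_setMem, Store.mem_setTmp,
            Store.size_setTmp, Store.env_setTmp, hf.size, hf.env, Function.update_apply]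
          by_cases hi' : i = σ.env (x + 1)
          · subst hi'
            simp [hz, hz']
          · simp [hi', hm₂ i hi]
  refine Ends.mono (ends_entry_seq (ends_prim_seq (by trivial) (hs' _ ?_))) (by omega)
    fun _ h => h
  simp

/-- One round of saturation of the `d + 1`-st table. -/
def reachRound (d x : ℕ) (s : Stmt) : Stmt :=
  forVar (d + 3) x (forVar (d + 6) (x + 1) (reachStep d x s))

/-- A sweep over all pairs marks the successors of everything marked at its start. It may also
follow marks made during the sweep, so from above the table is only bounded by a set `R` closed
under steps. -/
theorem ends_reachRound (hs : Computes L w s (d + 9) f T) {σ : Store} (hL : σ.size = L)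
    (hw : ∀ c < L, σ.mem c = w c) {R : ℕ → Prop} (hR : ∀ i < L, ∀ j < L, R i →
      f (Function.update (Function.update σ.env x i) (x + 1) j) ≠ 0 → R j)
    (hσ : ∀ i < L, σ.mem (L * (d + 1) + i) ≠ 0 → R i) :
    (reachRound d x s).Ends σ (L * (L * (T + 2 * d + 20 + 5) + 4 + 5) + 4) fun σ' =>
      Frame (· < d + 3) (L * (d + 1)) σ σ' ∧
        (∀ i < L, σ.mem (L * (d + 1) + i) ≠ 0 → σ'.mem (L * (d + 1) + i) ≠ 0) ∧
        (∀ i < L, σ'.mem (L * (d + 1) + i) ≠ 0 → R i) ∧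
        ∀ i < L, ∀ j < L, σ.mem (L * (d + 1) + i) ≠ 0 →
          f (Function.update (Function.update σ.env x i) (x + 1) j) ≠ 0 →
          σ'.mem (L * (d + 1) + j) ≠ 0 := by
  subst hL
  have hL : σ.size ≤ σ.size * (d + 1) := Nat.le_mul_of_pos_right _ (by omega)
  set b := σ.size * (d + 1) with hb
  refine (ends_forVar (a := b) (T := σ.size * (T + 2 * d + 20 + 5) + 4) (J := fun i' _ m =>
    (∀ i < σ.size, σ.mem (b + i) ≠ 0 → m (b + i) ≠ 0) ∧ (∀ i < σ.size, m (b + i) ≠ 0 → R i) ∧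
    ∀ i < σ.size, i' ≤ i → ∀ j < σ.size, σ.mem (b + i) ≠ 0 →
      f (Function.update (Function.update σ.env x i) (x + 1) j) ≠ 0 → m (b + j) ≠ 0)
      ⟨fun _ _ h => h, hσ, fun i h h' => absurd h (by omega)⟩ ?_).mono le_rfl ?_
  · rintro i₀ hi₀ σ₁ h1 h2 h3 h4 ⟨h5, h6, h7⟩
    refine (ends_forVar (a := b) (T := T + 2 * d + 20) (J := fun j' _ m =>
      (∀ i < σ.size, σ.mem (b + i) ≠ 0 → m (b + i) ≠ 0) ∧ (∀ i < σ.size, m (b + i) ≠ 0 → R i) ∧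
      (∀ i < σ.size, i₀ + 1 ≤ i → ∀ j < σ.size, σ.mem (b + i) ≠ 0 →
        f (Function.update (Function.update σ.env x i) (x + 1) j) ≠ 0 → m (b + j) ≠ 0) ∧
      ∀ j < σ.size, j' ≤ j → σ.mem (b + i₀) ≠ 0 →
        f (Function.update (Function.update σ.env x i₀) (x + 1) j) ≠ 0 → m (b + j) ≠ 0)
      ⟨h5, h6, h7, fun i h h' => absurd h (by omega)⟩ ?_).mono (by rw [h1]) ?_
    · rintro j₀ hj₀ σ₂ k1 k2 k3 k4 ⟨k5, k6, k7, k8⟩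
      rw [h1] at hj₀ k1
      have hx : σ₂.env x = i₀ := by
        rw [k2, h2]
        simp
      have hx' : σ₂.env (x + 1) = j₀ := by
        rw [k2]
        simp
      refine (ends_reachStep hs k1 (fun c hc => ?_) (by omega)).mono le_rfl ?_
      · rw [k4 c (by omega), h4 c (by omega), hw c hc]
      · rintro σ₃ ⟨hf, hm⟩
        rw [← hb, hx, hx', k2, h2] at hm
        refine ⟨hf.mono (fun k hk => hk.2) le_rfl, fun i hi h => (hm i hi).mpr (Or.inl (k5 i hi h)),
          ?_, fun i hi hi' j hj h h' => (hm j hj).mpr (Or.inl (k7 i hi hi' j hj h h')), ?_⟩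
        · intro i hi h
          rcases (hm i hi).mp h with h | ⟨rfl, h, h'⟩
          · exact k6 i hi h
          · exact hR i₀ hi₀ _ hi (k6 i₀ hi₀ h) h'
        · intro j hj hj' h h'
          by_cases hjj : j = j₀
          · subst hjj
            exact (hm j hj).mpr (Or.inr ⟨rfl, k5 i₀ hi₀ h, h'⟩)
          · exact (hm j hj).mpr (Or.inl (k8 j hj (by omega) h h'))
    · rintro σ' ⟨hf, k5, k6, k7, k8⟩
      refine ⟨hf.mono (fun k hk => hk.2) le_rfl, k5, k6, fun i hi hi' j hj h h' => ?_⟩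
      by_cases hii : i = i₀
      · subst hii
        exact k8 j hj (Nat.zero_le j) h h'
      · exact k7 i hi (by omega) j hj h h'
  · rintro σ' ⟨hf, h5, h6, h7⟩
    exact ⟨hf, h5, h6, fun i hi j hj h h' => h7 i hi (Nat.zero_le i) j hj h h'⟩

/-- The entries of the `d + 1`-st table that are to be marked. -/
def Reached (L : ℕ) (x : ℕ) (f₀ f : (ℕ → ℕ) → ℕ) (v : ℕ → ℕ) (j : ℕ) : Prop :=
  ∃ i < L, f₀ (Function.update v x i) ≠ 0 ∧ Relation.ReflTransGen (fun i j => i < L ∧ j < L ∧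
    f (Function.update (Function.update v x i) (x + 1) j) ≠ 0) i j

theorem Reached.of_closed {v : ℕ → ℕ} {M : ℕ → Prop}
    (h₀ : ∀ i < L, f₀ (Function.update v x i) ≠ 0 → M i)
    (h : ∀ i < L, ∀ j < L, M i →
      f (Function.update (Function.update v x i) (x + 1) j) ≠ 0 → M j) {j : ℕ}
    (hj : Reached L x f₀ f v j) : M j := by
  obtain ⟨i, hi, hi0, hij⟩ := hj
  induction hij with
  | refl => exact h₀ i hi hi0
  | tail _ hjk ih => exact h _ hjk.1 _ hjk.2.1 ih hjk.2.2

/-- A round that adds no mark has found a closed table, and at most `L` rounds can add one; hence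
`L` rounds suffice. -/
theorem ends_reachRounds (hs : Computes L w s (d + 9) f T) {σ : Store} (hL : σ.size = L)
    (hw : ∀ c < L, σ.mem c = w c)
    (hσ : ∀ i < L, σ.mem (L * (d + 1) + i) = f₀ (Function.update σ.env x i)) :
    (forVar d x (reachRound d x s)).Ends σ
      (L * (L * (L * (T + 2 * d + 20 + 5) + 4 + 5) + 4 + 5) + 4) fun σ' =>
      Frame (· < d) (L * (d + 1)) σ σ' ∧
        ∀ i < L, σ'.mem (L * (d + 1) + i) ≠ 0 ↔ Reached L x f₀ f σ.env i := by
  classical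
  subst hL
  have hL : σ.size ≤ σ.size * (d + 1) := Nat.le_mul_of_pos_right _ (by omega)
  set b := σ.size * (d + 1) with hb
  set R := Reached σ.size x f₀ f σ.env with hRdef
  have hR : ∀ i < σ.size, ∀ j < σ.size, R i →
      f (Function.update (Function.update σ.env x i) (x + 1) j) ≠ 0 → R j := by
    rintro i hi j hj ⟨k, hk, hk0, hki⟩ hij
    exact ⟨k, hk, hk0, hki.tail ⟨hi, hj, hij⟩⟩
  let M : (ℕ → ℕ) → Finset ℕ := fun m => {i ∈ Finset.range σ.size | m (b + i) ≠ 0}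
  -- With `k` rounds to go, the table is complete or already has at least `L - k` marks.
  refine (ends_forVar (a := b)
    (T := σ.size * (σ.size * (T + 2 * d + 20 + 5) + 4 + 5) + 4) (J := fun k _ m =>
    (∀ i < σ.size, f₀ (Function.update σ.env x i) ≠ 0 → m (b + i) ≠ 0) ∧
    (∀ i < σ.size, m (b + i) ≠ 0 → R i) ∧
    ((∀ i < σ.size, R i → m (b + i) ≠ 0) ∨ σ.size ≤ k + (M m).card)) ⟨?_, ?_, ?_⟩ ?_).mono le_rfl ?_
  · intro i hi h
    rwa [hσ i hi]
  · intro i hi h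
    rw [hσ i hi] at h
    exact ⟨i, hi, h, .refl⟩
  · exact Or.inr (Nat.le_add_right _ _)
  · rintro k hk σ₁ h1 h2 h3 h4 ⟨h5, h6, h7⟩
    -- Here `x` merely counts rounds, and each sweep overwrites it, so its value does not matter.
    have henv : ∀ i j, Function.update (Function.update σ₁.env x i) (x + 1) j =
        Function.update (Function.update σ.env x i) (x + 1) j := by
      intro i j
      rw [h2, Function.update_idem]
    refine (ends_reachRound hs h1 (fun c hc => (h4 c (by omega)).trans (hw c hc)) (R := R)
      (by simpa only [henv] using hR) h6).mono le_rfl ?_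
    rintro σ₂ ⟨hf, k1, k2, k3⟩
    simp only [henv] at k3
    refine ⟨hf.mono (fun k hk => hk.2) le_rfl, fun i hi h => k1 i hi (h5 i hi h), k2, ?_⟩
    rcases h7 with h7 | h7
    · exact Or.inl fun i hi h => k1 i hi (h7 i hi h)
    · have hsub : M σ₁.mem ⊆ M σ₂.mem := by
        intro i hi
        simp only [M, Finset.mem_filter, Finset.mem_range] at hi ⊢
        exact ⟨hi.1, k1 i hi.1 hi.2⟩
      by_cases heq : M σ₁.mem = M σ₂.mem
      · left
        have hmem : ∀ j < σ.size, σ₂.mem (b + j) ≠ 0 → σ₁.mem (b + j) ≠ 0 := by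
          intro j hj h
          have : j ∈ M σ₁.mem := by
            rw [heq]
            simpa [M] using ⟨hj, h⟩
          simpa [M, hj] using this
        intro i hi h
        apply k1 i hi
        exact h.of_closed (M := fun i => σ₁.mem (b + i) ≠ 0) h5
          fun i hi j hj h h' => hmem j hj (k3 i hi j hj h h')
      · right
        have := Finset.card_lt_card (hsub.ssubset_of_ne heq)
        omega
  · rintro σ' ⟨hf, h5, h6, h7⟩
    refine ⟨hf, fun i hi => ⟨h6 i hi, ?_⟩⟩
    rcases h7 with h7 | h7
    · exact h7 i hi
    · intro _
      -- No rounds are left, so the count forces all `L` entries to be marked.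
      have hM : M σ'.mem = Finset.range σ.size :=
        Finset.eq_of_subset_of_card_le (Finset.filter_subset _ _) (by simpa using h7)
      have : i ∈ M σ'.mem := by rw [hM]; simpa using hi
      simpa [M, hi] using this

/-- Look for a marked entry of the `d + 1`-st table at which `s₁` gives a non-zero value. -/
def reachFinal (d x : ℕ) (s₁ : Stmt) : Stmt :=
  seq (prim (.const (tmpReg d) 0)) <| forVar d x <| seq (entry (d + 3) (d + 1) x) <|
    seq (prim (.load (tmpReg (d + 3)) (tmpReg (d + 3)))) <| ifz (tmpReg (d + 3)) skip <|
      seq s₁ <| ifz (tmpReg (d + 3)) skip <| prim (.const (tmpReg d) 1)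

open Classical in
theorem ends_reachFinal (hs : Computes L w s₁ (d + 3) f₁ T₁) {σ : Store} (hL : σ.size = L)
    (hw : ∀ c < L, σ.mem c = w c) {R : ℕ → Prop}
    (hσ : ∀ i < L, σ.mem (L * (d + 1) + i) ≠ 0 ↔ R i) :
    (reachFinal d x s₁).Ends σ (1 + (L * (T₁ + d + 10 + 5) + 4)) fun σ' =>
      Frame (· < d) (L * (d + 1)) σ σ' ∧
        σ'.tmp d = if ∃ j < L, R j ∧ f₁ (Function.update σ.env x j) ≠ 0 then 1 else 0 := by
  subst hL
  refine ends_prim_seq (by trivial) ?_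
  have hL : σ.size ≤ σ.size * (d + 1) := Nat.le_mul_of_pos_right _ (by omega)
  have hL' : σ.size * (d + 3 + 1) = σ.size * (d + 1) + 3 * σ.size := by ring
  set b := σ.size * (d + 1) with hb
  refine (ends_forVar (a := b) (T := T₁ + d + 10) (J := fun i acc m =>
    (∀ k < σ.size, m (b + k) = σ.mem (b + k)) ∧
    acc = if ∃ j < σ.size, i ≤ j ∧ R j ∧ f₁ (Function.update σ.env x j) ≠ 0 then 1 else 0)
    ⟨by simp, ?_⟩ ?_).mono (by simp) ?_
  · rw [if_neg]
    · simp
    · rintro ⟨j, hj, hj', -⟩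
      simp at hj'
      omega
  · rintro i hi σ₁ h1 h2 h3 h4 ⟨h5, h6⟩
    simp only [act_const, Store.size_setTmp, Store.env_setTmp, Store.mem_setTmp] at h1 h2 h4 hi
    have hstep : (∃ j < σ.size, i ≤ j ∧ R j ∧ f₁ (Function.update σ.env x j) ≠ 0) ↔
        (∃ j < σ.size, i + 1 ≤ j ∧ R j ∧ f₁ (Function.update σ.env x j) ≠ 0) ∨
          (R i ∧ f₁ (Function.update σ.env x i) ≠ 0) := by
      constructor
      · rintro ⟨j, hj, hij, h⟩
        by_cases e : j = i
        · exact Or.inr (e ▸ h)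
        · exact Or.inl ⟨j, hj, by omega, h⟩
      · rintro (⟨j, hj, hij, h⟩ | h)
        · exact ⟨j, hj, by omega, h⟩
        · exact ⟨i, hi, le_rfl, h⟩
    simp only [hstep]
    refine Ends.mono (T := d + 1 + 2 + (1 + (T₁ + (1 + 2) + 2))) (ends_entry_seq (ends_prim_seq
      (by trivial) ?_)) (by omega) fun _ h => h
    rw [act_load]
    simp only [Store.tmp_setTmp, Function.update_self, Store.mem_setTmp, h1, h2]
    rw [h5 i hi]
    generalize hσ₂ : (σ₁.setTmp (d + 3) (b + i)).setTmp (d + 3) (σ.mem (b + i)) = σ₂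
    have hf : Frame (fun k => k < d + 3) b σ₁ σ₂ := by
      rw [← hσ₂]
      exact ((Frame.refl _ _ _).setTmp (by simp)).setTmp (by simp)
    have hm : σ₂.mem = σ₁.mem := by rw [← hσ₂]; simp
    have ht : σ₂.reg (tmpReg (d + 3)) = σ.mem (b + i) := by
      rw [← hσ₂]
      simp [Store.setTmp]
    refine ends_ifz (fun hz => ?_) (fun hz => ?_)
    · rw [ht] at hz
      have hRi : ¬ R i := fun h => (hσ i hi).mpr h hz
      refine (ends_skip ⟨hf.mono (fun k hk => hk.2) le_rfl, ?_, ?_⟩).mono (by omega) fun _ h => h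
      · rw [hm]; exact h5
      · rw [hf.tmp d (by omega), h6]
        simp [hRi]
    · rw [ht] at hz
      have hRi : R i := (hσ i hi).mp hz
      refine (hs σ₂ (hf.size.trans h1) fun c hc => ?_).seq ?_
      · rw [hm, h4 c (by omega), hw c hc]
      · rintro σ₃ ⟨hf₃, hv⟩
        have hf' : Frame (fun k => k < d + 3) b σ₁ σ₃ :=
          hf.trans hf₃ (fun k hk => ⟨hk, hk⟩) le_rfl (by omega)
        have hm₃ : ∀ k < σ.size, σ₃.mem (b + k) = σ.mem (b + k) := fun k hk => by
          rw [hf₃.mem _ (by omega), hm, h5 k hk]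
        have hv' : σ₃.reg (tmpReg (d + 3)) = f₁ (Function.update σ.env x i) := by
          rw [← h2, ← hf.env]; exact hv
        refine ends_ifz (fun hz' => ?_) (fun hz' => ?_)
        · rw [hv'] at hz'
          refine ends_skip ⟨hf'.mono (fun k hk => hk.2) le_rfl, hm₃, ?_⟩
          rw [hf'.tmp d (by omega), h6]
          simp [hz']
        · rw [hv'] at hz'
          refine ends_prim (by trivial) ?_
          rw [act_const]
          refine ⟨(hf'.mono (fun k hk => hk.2) le_rfl).setTmp (by simp), by simpa using hm₃, ?_⟩
          simp [hRi, hz']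
  · rintro σ' ⟨hf, -, hv⟩
    refine ⟨?_, ?_⟩
    · exact ((Frame.refl (· < d) b σ).setTmp (d := d) (v := 0) (by simp)).trans hf
        (fun k hk => ⟨hk, hk⟩) le_rfl le_rfl
    · simpa using hv

end Reach

end Stmt

/-! ### Compilation of expressions in polynomial time -/

namespace Expr

open Stmt

/-- The program that evaluates an expression. -/
def comp : Expr → ℕ → Stmt
  | const k, d => prim (.const (tmpReg d) k)
  | var x, d => prim (.move (tmpReg d) (varReg x))
  | add a b, d => seq (a.comp d) <| seq (b.comp (d + 1))
      (prim (.add (tmpReg d) (tmpReg d) (tmpReg (d + 1))))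
  | sub a b, d => seq (a.comp d) <| seq (b.comp (d + 1))
      (prim (.sub (tmpReg d) (tmpReg d) (tmpReg (d + 1))))
  | inp a, d => seq (a.comp d) <| seq (prim (.sub (tmpReg (d + 1)) 0 (tmpReg d))) <|
      ifz (tmpReg (d + 1)) (prim (.const (tmpReg d) 0)) (prim (.load (tmpReg d) (tmpReg d)))
  | ite c a b, d => seq (c.comp d) <| ifz (tmpReg d) (b.comp d) (a.comp d)
  | sum x a, d => seq (prim (.const (tmpReg d) 0)) <| forVar d x <| seq (a.comp (d + 3))
      (prim (.add (tmpReg d) (tmpReg d) (tmpReg (d + 3))))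
  | reach x a b c, d => seq (reachInit d x (a.comp (d + 3))) <|
      seq (forVar d x (reachRound d x (b.comp (d + 9)))) (reachFinal d x (c.comp (d + 3)))

-- For a fixed expression the nesting of loops is fixed, so the bounds compose to a polynomial in
-- `L`. Subexpressions run at depth `d + 3` under one loop and at `d + 9` under the three loops of
-- saturation, which keeps their registers and tables apart.
open Polynomial in
theorem exists_computes (e : Expr) (d : ℕ) :
    ∃ p : ℕ[X], ∀ L w, Computes L w (e.comp d) d (e.eval L w) (p.eval L) := by
  induction e generalizing d with
  | const k =>
    refine ⟨1, fun L w σ hL hw => ?_⟩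
    rw [eval_one]
    exact ends_prim (by trivial) ⟨(Frame.refl _ _ _).setTmp (by simp), by simp [eval]⟩
  | var x =>
    refine ⟨1, fun L w σ hL hw => ?_⟩
    rw [eval_one]
    exact ends_prim (by trivial) ⟨(Frame.refl _ _ _).setTmp (by simp), by simp [eval]⟩
  | add a b iha ihb =>
    obtain ⟨p, hp⟩ := iha d
    obtain ⟨q, hq⟩ := ihb (d + 1)
    refine ⟨p + (q + 1), fun L w σ hL hw => ?_⟩
    have hle : L * (d + 1) ≤ L * (d + 1 + 1) := Nat.mul_le_mul_left _ (by omega)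
    have hL1 : L ≤ L * (d + 1) := Nat.le_mul_of_pos_right _ (by omega)
    rw [eval_add, eval_add, eval_one]
    refine (hp L w σ hL hw).seq ?_
    rintro σ₁ ⟨hf₁, hv₁⟩
    refine (hq L w σ₁ (hf₁.size.trans hL) fun c hc => ?_).seq ?_
    · rw [hf₁.mem c (by omega), hw c hc]
    · rintro σ₂ ⟨hf₂, hv₂⟩
      refine ends_prim (by trivial) ?_
      rw [act_add]
      refine ⟨(hf₁.trans hf₂ (fun k hk => ⟨hk, by omega⟩) le_rfl hle).setTmp (by simp), ?_⟩
      simp only [Store.tmp_setTmp, Function.update_self, eval]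
      rw [hf₂.tmp d (by omega), hv₁, hv₂, hf₁.env]
  | sub a b iha ihb =>
    obtain ⟨p, hp⟩ := iha d
    obtain ⟨q, hq⟩ := ihb (d + 1)
    refine ⟨p + (q + 1), fun L w σ hL hw => ?_⟩
    have hle : L * (d + 1) ≤ L * (d + 1 + 1) := Nat.mul_le_mul_left _ (by omega)
    have hL1 : L ≤ L * (d + 1) := Nat.le_mul_of_pos_right _ (by omega)
    rw [eval_add, eval_add, eval_one]
    refine (hp L w σ hL hw).seq ?_
    rintro σ₁ ⟨hf₁, hv₁⟩
    refine (hq L w σ₁ (hf₁.size.trans hL) fun c hc => ?_).seq ?_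
    · rw [hf₁.mem c (by omega), hw c hc]
    · rintro σ₂ ⟨hf₂, hv₂⟩
      refine ends_prim (by trivial) ?_
      rw [act_sub]
      refine ⟨(hf₁.trans hf₂ (fun k hk => ⟨hk, by omega⟩) le_rfl hle).setTmp (by simp), ?_⟩
      simp only [Store.tmp_setTmp, Function.update_self, eval]
      rw [hf₂.tmp d (by omega), hv₁, hv₂, hf₁.env]
  | inp a iha =>
    obtain ⟨p, hp⟩ := iha d
    refine ⟨p + 4, fun L w σ hL hw => ?_⟩
    have hL1 : L ≤ L * (d + 1) := Nat.le_mul_of_pos_right _ (by omega)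
    rw [eval_add, show (4 : ℕ[X]).eval L = 1 + (1 + 2) by simp]
    refine (hp L w σ hL hw).seq ?_
    rintro σ₁ ⟨hf₁, hv₁⟩
    refine ends_prim_seq (by trivial) ?_
    -- This difference is non-zero exactly for positions inside the input; cells beyond it may hold
    -- tables and must not be read.
    rw [act_size_sub, hv₁, hf₁.size, hL]
    have hreg : (σ₁.setTmp (d + 1) (L - a.eval L w σ.env)).reg (tmpReg (d + 1)) =
        L - a.eval L w σ.env := by simp [Store.setTmp]
    refine ends_ifz (fun hz => ?_) (fun hz => ?_) <;> rw [hreg] at hz <;>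
      refine ends_prim (by trivial) ?_
    · rw [act_const]
      refine ⟨(hf₁.setTmp (by simp)).setTmp (by simp), ?_⟩
      simp only [Store.tmp_setTmp, Function.update_self, eval]
      rw [if_neg (by omega)]
    · rw [act_load]
      refine ⟨(hf₁.setTmp (by simp)).setTmp (by simp), ?_⟩
      have hlt : a.eval L w σ.env < L := by omega
      simp only [Store.tmp_setTmp, Function.update_self, eval, Store.mem_setTmp]
      rw [if_pos hlt, Function.update_of_ne (by omega), hv₁, hf₁.mem _ (by omega), hw _ hlt]
  | ite c a b ihc iha ihb =>
    obtain ⟨p, hp⟩ := ihc d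
    obtain ⟨q, hq⟩ := iha d
    obtain ⟨r, hr⟩ := ihb d
    refine ⟨p + (q + r + 2), fun L w σ hL hw => ?_⟩
    have hL1 : L ≤ L * (d + 1) := Nat.le_mul_of_pos_right _ (by omega)
    rw [eval_add, eval_add, eval_add, show (2 : ℕ[X]).eval L = 2 by simp]
    refine (hp L w σ hL hw).seq ?_
    rintro σ₁ ⟨hf₁, hv₁⟩
    have hw₁ : ∀ c < L, σ₁.mem c = w c := fun c hc => by rw [hf₁.mem c (by omega), hw c hc]
    refine ends_ifz (fun hz => ?_) (fun hz => ?_)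
    · refine (hr L w σ₁ (hf₁.size.trans hL) hw₁).mono (by omega) ?_
      rintro σ₂ ⟨hf₂, hv₂⟩
      refine ⟨hf₁.trans hf₂ (fun k hk => ⟨hk, hk⟩) le_rfl le_rfl, ?_⟩
      have hz' : c.eval L w σ.env = 0 := by rw [← hv₁]; exact hz
      rw [hv₂, hf₁.env, eval, if_pos hz']
    · refine (hq L w σ₁ (hf₁.size.trans hL) hw₁).mono (by omega) ?_
      rintro σ₂ ⟨hf₂, hv₂⟩
      refine ⟨hf₁.trans hf₂ (fun k hk => ⟨hk, hk⟩) le_rfl le_rfl, ?_⟩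
      have hz' : c.eval L w σ.env ≠ 0 := by rw [← hv₁]; exact hz
      rw [hv₂, hf₁.env, eval, if_neg hz']
  | sum x a iha =>
    obtain ⟨p, hp⟩ := iha (d + 3)
    refine ⟨1 + (X * (p + 1 + 5) + 4), fun L w => ?_⟩
    have := computes_sum (x := x) (hp L w)
    simpa [comp, eval] using this
  | reach x a b c iha ihb ihc =>
    obtain ⟨p, hp⟩ := iha (d + 3)
    obtain ⟨q, hq⟩ := ihb (d + 9)
    obtain ⟨r, hr⟩ := ihc (d + 3)
    refine ⟨(X * (p + ((d : ℕ[X]) + 1 + 2 + 1) + 5) + 4) +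
      ((X * (X * (X * (q + 2 * (d : ℕ[X]) + 20 + 5) + 4 + 5) + 4 + 5) + 4) +
        (1 + (X * (r + (d : ℕ[X]) + 10 + 5) + 4))), fun L w σ hL hw => ?_⟩
    have hL1 : L ≤ L * (d + 1) := Nat.le_mul_of_pos_right _ (by omega)
    simp only [eval_add, eval_mul, eval_X, eval_natCast, eval_one, eval_ofNat]
    refine (ends_reachInit (hp L w) hL hw).seq ?_
    rintro σ₁ ⟨hf₁, hv₁⟩
    have hw₁ : ∀ c < L, σ₁.mem c = w c := fun c hc => by rw [hf₁.mem c (by omega), hw c hc]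
    rw [← hf₁.env] at hv₁
    refine (ends_reachRounds (hq L w) (hf₁.size.trans hL) hw₁ hv₁).seq ?_
    rintro σ₂ ⟨hf₂, hv₂⟩
    have hw₂ : ∀ c < L, σ₂.mem c = w c := fun c hc => by rw [hf₂.mem c (by omega), hw₁ c hc]
    refine (ends_reachFinal (x := x) (hr L w) (hf₂.size.trans (hf₁.size.trans hL)) hw₂ hv₂).mono
      le_rfl ?_
    rintro σ₃ ⟨hf₃, hv₃⟩
    refine ⟨(hf₁.trans hf₂ (fun k hk => ⟨hk, hk⟩) le_rfl le_rfl).trans hf₃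
      (fun k hk => ⟨hk, hk⟩) le_rfl le_rfl, ?_⟩
    rw [hv₃, hf₂.env, hf₁.env, eval]
    congr 1
    apply propext
    constructor
    · rintro ⟨j, hj, ⟨i, hi, hi0, hij⟩, hj1⟩
      exact ⟨i, hi, j, hj, hi0, hij, hj1⟩
    · rintro ⟨i, hi, j, hj, hi0, hij, hj1⟩
      exact ⟨j, hj, ⟨i, hi, hi0, hij⟩, hj1⟩

end Expr

end RAM

/-- Properties defined by an expression are decidable in polynomial time. -/
theorem decidableInPolyTime_of_expr {α : Type*} {enc : α → List Bool} {Q : α → Prop}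
    (e : RAM.Expr) (h : ∀ x, e.eval (enc x).length (fun a => ((enc x).getD a false).toNat)
      (fun _ => 0) ≠ 0 ↔ Q x) : DecidableInPolyTime enc Q := by
  obtain ⟨p, hp⟩ := e.exists_computes 0
  -- Register `0` holds the input length throughout the evaluation and receives the answer only at
  -- the end.
  let s : RAM.Stmt := (e.comp 0).seq (.prim (.move 0 (RAM.tmpReg 0)))
  refine ⟨s.code 0, p + 1, fun x => ?_⟩
  let σ : RAM.Store := ⟨(RAM.init (enc x)).reg, (RAM.init (enc x)).mem⟩
  obtain ⟨σ', t, ht, hrun, hσ'⟩ := (hp (enc x).length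
    (fun a => ((enc x).getD a false).toNat) σ (by simp [σ, RAM.init, RAM.Store.size])
    (fun _ _ => rfl)).seq (t := .prim (.move 0 (RAM.tmpReg 0))) (n := 1)
      (R := fun σ' => σ'.reg 0 = e.eval (enc x).length
        (fun a => ((enc x).getD a false).toNat) σ.env) (by
      rintro σ₁ ⟨-, hv⟩
      refine RAM.Stmt.ends_prim (by trivial) ?_
      rw [← hv]
      simp [RAM.Instr.act, RAM.Instr.exec, RAM.Store.tmp])
  have hit : (RAM.step (s.code 0))^[t] (RAM.init (enc x)) = ⟨0 + s.len, σ'.reg, σ'.mem⟩ :=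
    hrun.iterate_step (P := s.code 0) (o := 0) fun k i h => by simpa using h
  refine ⟨t, by simpa using ht, ?_, ?_⟩
  · rw [hit, RAM.Halted, RAM.Stmt.length_code]
    simp
  · rw [hit, ← h x]
    change σ'.reg 0 ≠ 0 ↔ _
    have henv : σ.env = fun _ => 0 := by
      funext y
      simp [RAM.Store.env, σ, RAM.init, RAM.varReg]
    rw [hσ', henv]

/-! ### Formulas -/

namespace RAM

namespace Expr

/-- Negation. -/
def not (a : Expr) : Expr := ite a (const 0) (const 1)
/-- Conjunction. -/
def and (a b : Expr) : Expr := ite a b (const 0)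
/-- Disjunction. -/
def or (a b : Expr) : Expr := ite a (const 1) b
/-- Strict order. -/
def lt (a b : Expr) : Expr := sub b a
/-- Equality. -/
def eq (a b : Expr) : Expr := not (add (sub a b) (sub b a))
/-- Product, for `a` at most the length of the input. -/
def mul (a b : Expr) : Expr := sum 2 (ite (lt (var 2) a) b (const 0))

/-- The value of an expression, as a truth value. -/
def Holds (L : ℕ) (w : ℕ → ℕ) (e : Expr) (v : ℕ → ℕ) : Prop := e.eval L w v ≠ 0

variable {L : ℕ} {w : ℕ → ℕ}

@[simp] theorem holds_not {a : Expr} {v} : Holds L w a.not v ↔ ¬ Holds L w a v := by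
  unfold Holds not
  simp only [eval]
  split_ifs with h <;> simp [h]
@[simp] theorem holds_and {a b : Expr} {v} :
    Holds L w (a.and b) v ↔ Holds L w a v ∧ Holds L w b v := by
  unfold Holds and
  simp only [eval]
  split_ifs with h <;> simp [h]
@[simp] theorem holds_or {a b : Expr} {v} :
    Holds L w (a.or b) v ↔ Holds L w a v ∨ Holds L w b v := by
  unfold Holds or
  simp only [eval]
  split_ifs with h <;> simp [h]
@[simp] theorem holds_lt {a b : Expr} {v} :
    Holds L w (a.lt b) v ↔ a.eval L w v < b.eval L w v := by
  unfold Holds lt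
  simp only [eval]
  omega
@[simp] theorem holds_eq {a b : Expr} {v} :
    Holds L w (a.eq b) v ↔ a.eval L w v = b.eval L w v := by
  unfold eq
  rw [holds_not, Holds]
  simp only [eval]
  omega
@[simp] theorem holds_sum {x : ℕ} {a : Expr} {v} :
    Holds L w (sum x a) v ↔ ∃ i < L, Holds L w a (Function.update v x i) := by
  simp [Holds, eval, Finset.sum_eq_zero_iff]

/-- The product is a sum of `i` copies of `j`. The first two hypotheses say that the bound variable
`2` does not affect the factors. -/
theorem eval_mul {a b : Expr} {v : ℕ → ℕ} {i j : ℕ}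
    (ha : ∀ k, a.eval L w (Function.update v 2 k) = i)
    (hb : ∀ k, b.eval L w (Function.update v 2 k) = j) (hi : i ≤ L) :
    (mul a b).eval L w v = i * j := by
  have h : ∀ k, (ite (lt (var 2) a) b (const 0)).eval L w (Function.update v 2 k) =
      if k < i then j else 0 := by
    intro k
    have : (lt (var 2) a).eval L w (Function.update v 2 k) = i - k := by
      simp [lt, eval, ha]
    simp only [eval, this, hb]
    split_ifs <;> first | rfl | omega
  rw [mul, eval, Finset.sum_congr rfl fun k _ => h k, ← Finset.sum_filter, Finset.sum_const, smul_eq_mul]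
  congr 1
  have : Finset.filter (fun k => k < i) (Finset.range L) = Finset.range i := by
    ext k
    simp
    omega
  rw [this, Finset.card_range]

end Expr

/-- Steps of `r'` occur only between codes, so a chain that starts at a code stays among codes;
injectivity makes consecutive steps match. -/
theorem reflTransGen_encode {α : Type*} {c : α → ℕ} (hc : Function.Injective c)
    {r : α → α → Prop} {r' : ℕ → ℕ → Prop}
    (h : ∀ i j, r' i j ↔ ∃ a b, i = c a ∧ j = c b ∧ r a b) (a b : α) :
    Relation.ReflTransGen r' (c a) (c b) ↔ Relation.ReflTransGen r a b := by
  constructor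
  · intro hab
    have : ∀ j, Relation.ReflTransGen r' (c a) j → ∃ b, j = c b ∧ Relation.ReflTransGen r a b := by
      intro j hj
      induction hj with
      | refl => exact ⟨a, rfl, .refl⟩
      | tail _ hjk ih =>
        obtain ⟨b, rfl, hb⟩ := ih
        obtain ⟨b', k', hbb', rfl, hr⟩ := (h _ _).mp hjk
        obtain rfl := hc hbb'
        exact ⟨k', rfl, hb.tail hr⟩
    obtain ⟨b', hb', hr⟩ := this _ hab
    exact hc hb' ▸ hr
  · intro hab
    induction hab with
    | refl => exact .refl
    | tail _ hr ih => exact ih.tail ((h _ _).mpr ⟨_, _, rfl, rfl, hr⟩)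

/-- The word `w` of length `L` starts with the encoding of the graph `G`. -/
structure Encodes {n : ℕ} (G : SimpleGraph (Fin n)) (L : ℕ) (w : ℕ → ℕ) : Prop where
  ones : ∀ i < n, w i ≠ 0
  zero : w n = 0
  lt : n < L
  two_mul_le : n + n ≤ L
  adj_lt : ∀ i j : Fin n, n + 1 + (i * n + j) < L
  adj : ∀ i j : Fin n, w (n + 1 + (i * n + j)) ≠ 0 ↔ G.Adj i j

/-! ### Formulas for the criterion, with distinct numbers for nested bound variables -/

namespace Expr

/-- The number of vertices. -/
def verts : Expr :=
  sum 0 (not (sum 1 (not (or (lt (var 0) (var 1)) (inp (var 1))))))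

/-- Existential quantification over vertices. -/
def exV (x : ℕ) (a : Expr) : Expr := sum x (and (lt (var x) verts) a)

/-- Adjacency of two vertices. -/
def adj (x y : ℕ) : Expr :=
  inp (add (add verts (const 1)) (add (mul (var x) verts) (var y)))

/-- Reachability of two vertices. -/
def conn (x y : ℕ) : Expr :=
  reach 7 (eq (var 7) (var x)) (and (lt (var 7) verts) (and (lt (var 8) verts) (adj 7 8)))
    (eq (var 7) (var y))

variable {n : ℕ} {G : SimpleGraph (Fin n)} {L : ℕ} {w : ℕ → ℕ}

/-- A position is counted if no letter up to and including it is `0`; these are the `n` ones before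
the first zero. -/
theorem eval_verts (hG : Encodes G L w) (v : ℕ → ℕ) : verts.eval L w v = n := by
  have h : ∀ i ∈ Finset.range L,
      (not (sum 1 (not (or (lt (var 0) (var 1)) (inp (var 1)))))).eval L w (Function.update v 0 i) =
        if i < n then 1 else 0 := by
    intro i hi
    have hh : Holds L w (sum 1 (not (or (lt (var 0) (var 1)) (inp (var 1)))))
        (Function.update v 0 i) ↔ n ≤ i := by
      simp only [holds_sum, holds_not, holds_or, holds_lt, eval, Function.update_self]
      constructor
      · rintro ⟨j, hj, h⟩
        push Not at h
        by_contra hin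
        have h1 : j ≤ i := by simpa using h.1
        have h2 := h.2
        simp only [Holds, eval, Function.update_self, if_pos hj] at h2
        exact hG.ones j (by omega) (by simpa using h2)
      · intro hin
        refine ⟨n, hG.lt, ?_⟩
        push Not
        exact ⟨by simpa using hin, by simp [Holds, eval, hG.zero]⟩
    unfold Holds at hh
    rw [not, eval]
    by_cases hin : i < n
    · rw [if_pos (by_contra fun hc => absurd (hh.mp hc) (by omega)), if_pos hin, eval]
    · rw [if_neg (hh.mpr (by omega)), if_neg hin, eval]
  rw [verts, eval, Finset.sum_congr rfl h, ← Finset.sum_filter, Finset.sum_const, smul_eq_mul,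
    mul_one]
  have : Finset.filter (fun k => k < n) (Finset.range L) = Finset.range n := by
    ext k
    have := hG.lt
    simp
    omega
  rw [this, Finset.card_range]

theorem holds_exV (hG : Encodes G L w) {x : ℕ} {a : Expr} {v : ℕ → ℕ} :
    Holds L w (exV x a) v ↔ ∃ i : Fin n, Holds L w a (Function.update v x i) := by
  simp only [exV, holds_sum, holds_and, holds_lt, eval_verts hG, eval, Function.update_self]
  constructor
  · rintro ⟨i, -, hi, h⟩
    exact ⟨⟨i, hi⟩, h⟩
  · rintro ⟨i, h⟩
    exact ⟨i, i.2.trans hG.lt, i.2, h⟩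

theorem holds_adj (hG : Encodes G L w) {x y : ℕ} (hx : x ≠ 2) {v : ℕ → ℕ}
    {i j : Fin n} (hi : v x = i) (hj : v y = j) : Holds L w (adj x y) v ↔ G.Adj i j := by
  have hm : (mul (var x) verts).eval L w v = i * n :=
    eval_mul (by simp [eval, hx, hi]) (fun _ => eval_verts hG _) (i.2.trans hG.lt).le
  have := hG.adj_lt i j
  simp only [Holds, adj, eval, hm, eval_verts hG, hj]
  rw [if_pos this, hG.adj]

theorem holds_reach {α : Type*} {c : α → ℕ} (hc : Function.Injective c) (hcL : ∀ a, c a < L)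
    {x : ℕ} {e₀ e e₁ : Expr} {v : ℕ → ℕ} {r : α → α → Prop} {a b : α}
    (h₀ : ∀ i, Holds L w e₀ (Function.update v x i) ↔ i = c a)
    (h : ∀ i j, Holds L w e (Function.update (Function.update v x i) (x + 1) j) ↔
      ∃ a b, i = c a ∧ j = c b ∧ r a b)
    (h₁ : ∀ i, Holds L w e₁ (Function.update v x i) ↔ i = c b) :
    Holds L w (reach x e₀ e e₁) v ↔ Relation.ReflTransGen r a b := by
  unfold Holds at h₀ h h₁
  have hr : ∀ i j, (i < L ∧ j < L ∧
      e.eval L w (Function.update (Function.update v x i) (x + 1) j) ≠ 0) ↔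
      ∃ a b, i = c a ∧ j = c b ∧ r a b := by
    intro i j
    rw [h]
    constructor
    · rintro ⟨-, -, h⟩
      exact h
    · rintro ⟨a, b, rfl, rfl, h⟩
      exact ⟨hcL _, hcL _, a, b, rfl, rfl, h⟩
  rw [Holds, eval, ← reflTransGen_encode hc hr]
  simp only [h₀, h₁, ne_eq, ite_eq_right_iff, one_ne_zero, imp_false, not_not]
  constructor
  · rintro ⟨i, -, j, -, rfl, h, rfl⟩
    exact h
  · intro h
    exact ⟨_, hcL a, _, hcL b, rfl, h, rfl⟩

theorem holds_conn (hG : Encodes G L w) {x y : ℕ} (hx : x ≠ 7) (hy : y ≠ 7) {v : ℕ → ℕ}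
    {i j : Fin n} (hi : v x = i) (hj : v y = j) :
    Holds L w (conn x y) v ↔ G.Reachable i j := by
  rw [SimpleGraph.reachable_iff_reflTransGen]
  refine holds_reach (c := fun i : Fin n => (i : ℕ)) Fin.val_injective
    (fun a => a.2.trans hG.lt) ?_ ?_ ?_
  · simp [eval, hx, hi]
  · intro k l
    simp only [holds_and, holds_lt, eval_verts hG, eval, Function.update_self]
    constructor
    · rintro ⟨h1, h2, h3⟩
      have h1' : k < n := by simpa using h1
      exact ⟨⟨k, h1'⟩, ⟨l, h2⟩, rfl, rfl, (holds_adj hG (by decide) (by simp) (by simp)).mp h3⟩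
    · rintro ⟨a, b, rfl, rfl, h⟩
      exact ⟨by simp, b.2, (holds_adj hG (by decide) (by simp) (by simp)).mpr h⟩
  · simp [eval, hy, hj]

/-- Membership in the set of vertices forced to the side of `a` by a cut edge `ab`. -/
def known (inS : ℕ → Expr) (a b z : ℕ) : Expr :=
  or (eq (var z) (var a)) <| or (and (adj z a) (and (not (adj z b)) (not (eq (var z) (var b)))))
    (and (inS z) (conn a z))

theorem holds_known (hG : Encodes G L w) {inS : ℕ → Expr} {a b z : ℕ} (ha7 : a ≠ 7) (hz2 : z ≠ 2)
    (hz7 : z ≠ 7) {v : ℕ → ℕ} {i j k : Fin n} (ha : v a = i) (hb : v b = j) (hz : v z = k)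
    {S : Set (Fin n)} (hS : Holds L w (inS z) v ↔ k ∈ S) :
    Holds L w (known inS a b z) v ↔ G.KnownIn S i j k := by
  simp only [known, holds_or, holds_and, holds_not, holds_eq, holds_adj hG hz2 hz ha,
    holds_adj hG hz2 hz hb, holds_conn hG ha7 hz7 ha hz, hS, eval, ha, hb, hz, Fin.val_inj,
    SimpleGraph.KnownIn, ne_eq]

/-- The number of a literal. -/
def litCode (l : Fin n × Bool) : ℕ := if l.2 then l.1 else l.1 + n

theorem litCode_injective : Function.Injective (litCode (n := n)) := by
  rintro ⟨i, _ | _⟩ ⟨j, _ | _⟩ h <;> simp [litCode] at h ⊢ <;> omega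

theorem litCode_lt (l : Fin n × Bool) : litCode l < n + n := by
  unfold litCode
  split_ifs <;> omega

/-- Positive literals take the numbers below `n`, negative ones those from `n` to `2 * n - 1`. -/
theorem lt_iff_exists_litCode {i : ℕ} : i < n + n ↔ ∃ l : Fin n × Bool, i = litCode l := by
  constructor
  · intro h
    by_cases hi : i < n
    · exact ⟨(⟨i, hi⟩, true), by simp [litCode]⟩
    · exact ⟨(⟨i - n, by omega⟩, false), by simp [litCode]; omega⟩
  · rintro ⟨l, rfl⟩
    exact litCode_lt l

/-- Two literals are negations of each other. -/
def isNeg (p q : ℕ) : Expr :=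
  or (and (lt (var p) verts) (eq (var q) (add (var p) verts)))
    (and (lt (var q) verts) (eq (var p) (add (var q) verts)))

theorem holds_isNeg (hG : Encodes G L w) {p q : ℕ} {v : ℕ → ℕ} :
    Holds L w (isNeg p q) v ↔
      ∃ l : Fin n × Bool, v p = litCode l ∧ v q = litCode (TwoSat.neg l) := by
  simp only [isNeg, holds_or, holds_and, holds_lt, holds_eq, eval, eval_verts hG]
  constructor
  · rintro (⟨h1, h2⟩ | ⟨h1, h2⟩)
    · exact ⟨(⟨v p, h1⟩, true), by simp [litCode, TwoSat.neg, h2]⟩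
    · exact ⟨(⟨v q, h1⟩, false), by simp [litCode, TwoSat.neg, h2]⟩
  · rintro ⟨⟨i, _ | _⟩, h1, h2⟩ <;> simp_all [litCode, TwoSat.neg]

/-- A vertex, as a positive literal, is one of the literals `9` and `11` or forced. -/
def grantedIn (inA : ℕ → Expr) (z : ℕ) : Expr :=
  or (eq (var z) (var 9)) (or (eq (var z) (var 11)) (known inA 5 6 z))

/-- A vertex, as a negative literal, is one of the literals `9` and `11` or forced. -/
def grantedOut (inB : ℕ → Expr) (z : ℕ) : Expr :=
  or (eq (add (var z) verts) (var 9)) (or (eq (add (var z) verts) (var 11)) (known inB 6 5 z))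

/-- The two vertices are distinct and not adjacent. -/
def apart (x y : ℕ) : Expr := and (not (eq (var x) (var y))) (not (adj x y))

/-- The literals `9` and `11` cannot both be true, for the cut edge with ends `5` and `6`. -/
def forbids (inA inB : ℕ → Expr) : Expr :=
  or (and (eq (var 9) (var 11)) <| exV 14 <|
      or (and (eq (add (var 14) verts) (var 9)) (known inA 5 6 14))
        (and (eq (var 14) (var 9)) (known inB 6 5 14))) <|
    exV 14 <| exV 15 <| exV 16 <| exV 17 <| and (adj 14 15) <| and (adj 16 17) <|
      and (or (apart 14 16) (apart 15 17)) <| and (grantedIn inA 14) <| and (grantedIn inA 16) <|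
      and (grantedOut inB 15) (grantedOut inB 17)

/-- For valuations that agree with `u` on the variables `18` and `19`, the formula `inS`
defines `S`. -/
def Defines (L : ℕ) (w u : ℕ → ℕ) (inS : ℕ → Expr) (S : Set (Fin n)) : Prop :=
  ∀ v : ℕ → ℕ, v 18 = u 18 → v 19 = u 19 → ∀ z, z ≠ 2 → ∀ k : Fin n, v z = k →
    (Holds L w (inS z) v ↔ k ∈ S)

variable {inA inB : ℕ → Expr} {A B : Set (Fin n)} {u v : ℕ → ℕ} {a b : Fin n}

theorem holds_grantedIn (hG : Encodes G L w) (hA : Defines L w u inA A) (h5 : v 5 = a)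
    (h6 : v 6 = b) (h18 : v 18 = u 18) (h19 : v 19 = u 19) {l m : Fin n × Bool}
    (h9 : v 9 = litCode l) (h11 : v 11 = litCode m) {z : ℕ} (hz2 : z ≠ 2) (hz7 : z ≠ 7)
    {k : Fin n} (hz : v z = k) :
    Holds L w (grantedIn inA z) v ↔ G.GrantedBy A B a b l m (k, true) := by
  have hk : (k : ℕ) = litCode (k, true) := by simp [litCode]
  simp only [grantedIn, holds_or, holds_eq, eval, h9, h11, hz, hk, litCode_injective.eq_iff,
    holds_known hG (a := 5) (b := 6) (by decide) hz2 hz7 h5 h6 hz (hA v h18 h19 z hz2 k hz),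
    SimpleGraph.GrantedBy, SimpleGraph.KnownLit, if_true]

theorem holds_grantedOut (hG : Encodes G L w) (hB : Defines L w u inB B) (h5 : v 5 = a)
    (h6 : v 6 = b) (h18 : v 18 = u 18) (h19 : v 19 = u 19) {l m : Fin n × Bool}
    (h9 : v 9 = litCode l) (h11 : v 11 = litCode m) {z : ℕ} (hz2 : z ≠ 2) (hz7 : z ≠ 7)
    {k : Fin n} (hz : v z = k) :
    Holds L w (grantedOut inB z) v ↔ G.GrantedBy A B a b l m (k, false) := by
  have hk : (k : ℕ) + n = litCode (k, false) := by simp [litCode]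
  simp only [grantedOut, holds_or, holds_eq, eval, eval_verts hG, h9, h11, hz, hk,
    litCode_injective.eq_iff,
    holds_known hG (a := 6) (b := 5) (by decide) hz2 hz7 h6 h5 hz (hB v h18 h19 z hz2 k hz),
    SimpleGraph.GrantedBy, SimpleGraph.KnownLit, Bool.false_eq_true, if_false]

theorem holds_apart (hG : Encodes G L w) {x y : ℕ} (hx : x ≠ 2) {i j : Fin n} (hi : v x = i)
    (hj : v y = j) : Holds L w (apart x y) v ↔ i ≠ j ∧ ¬ G.Adj i j := by
  simp only [apart, holds_and, holds_not, holds_eq, eval, hi, hj, Fin.val_inj,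
    holds_adj hG hx hi hj, ne_eq]

theorem holds_forbids (hG : Encodes G L w) (hA : Defines L w u inA A) (hB : Defines L w u inB B)
    (h5 : v 5 = a) (h6 : v 6 = b) (h18 : v 18 = u 18) (h19 : v 19 = u 19) {l m : Fin n × Bool}
    (h9 : v 9 = litCode l) (h11 : v 11 = litCode m) :
    Holds L w (forbids inA inB) v ↔ G.Forbids A B a b l m := by
  rw [forbids, holds_or, SimpleGraph.Forbids]
  refine or_congr ?_ ?_
  · rw [holds_and, holds_exV hG, holds_eq]
    simp only [eval, h9, h11, litCode_injective.eq_iff]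
    refine and_congr Iff.rfl ?_
    -- The unit clause: the vertex of literal `9` is recovered by quantifying over it, and the
    -- opposite literal is tested for being known.
    have hk : ∀ k : Fin n, Holds L w
        (or (and (eq (add (var 14) verts) (var 9)) (known inA 5 6 14))
          (and (eq (var 14) (var 9)) (known inB 6 5 14))) (Function.update v 14 k) ↔
        ((k, false) = l ∧ G.KnownIn A a b k) ∨ ((k, true) = l ∧ G.KnownIn B b a k) := by
      intro k
      set v' := Function.update v 14 (k : ℕ) with hv'
      have e5 : v' 5 = a := by simp [hv', h5]
      have e6 : v' 6 = b := by simp [hv', h6]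
      have e9 : v' 9 = litCode l := by simp [hv', h9]
      have e18 : v' 18 = u 18 := by simp [hv', h18]
      have e19 : v' 19 = u 19 := by simp [hv', h19]
      have e14 : v' 14 = k := by simp [hv']
      rw [holds_or, holds_and, holds_and, holds_eq, holds_eq,
        holds_known hG (by decide) (by decide) (by decide) e5 e6 e14
          (hA v' e18 e19 14 (by decide) k e14),
        holds_known hG (by decide) (by decide) (by decide) e6 e5 e14
          (hB v' e18 e19 14 (by decide) k e14)]
      have hkt : (k : ℕ) = litCode (k, true) := by simp [litCode]
      have hkf : (k : ℕ) + n = litCode (k, false) := by simp [litCode]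
      simp only [eval, eval_verts hG, e9, e14, hkf]
      rw [hkt]
      simp only [litCode_injective.eq_iff]
    simp only [hk]
    obtain ⟨k, _ | _⟩ := l <;> simp [SimpleGraph.KnownLit]
  · simp only [holds_exV hG]
    refine exists_congr fun x => exists_congr fun y => exists_congr fun x' =>
      exists_congr fun y' => ?_
    set v' := Function.update (Function.update (Function.update (Function.update v 14 (x : ℕ)) 15
      (y : ℕ)) 16 (x' : ℕ)) 17 (y' : ℕ) with hv'
    have e5 : v' 5 = a := by simp [hv', h5]
    have e6 : v' 6 = b := by simp [hv', h6]
    have e9 : v' 9 = litCode l := by simp [hv', h9]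
    have e11 : v' 11 = litCode m := by simp [hv', h11]
    have e18 : v' 18 = u 18 := by simp [hv', h18]
    have e19 : v' 19 = u 19 := by simp [hv', h19]
    have e14 : v' 14 = x := by simp [hv']
    have e15 : v' 15 = y := by simp [hv']
    have e16 : v' 16 = x' := by simp [hv']
    have e17 : v' 17 = y' := by simp [hv']
    simp only [holds_and, holds_or, holds_adj hG (by decide : 14 ≠ 2) e14 e15,
      holds_adj hG (by decide : 16 ≠ 2) e16 e17, holds_apart hG (by decide : 14 ≠ 2) e14 e16,
      holds_apart hG (by decide : 15 ≠ 2) e15 e17]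
    rw [holds_grantedIn (B := B) hG hA e5 e6 e18 e19 e9 e11 (by decide) (by decide) e14,
      holds_grantedIn (B := B) hG hA e5 e6 e18 e19 e9 e11 (by decide) (by decide) e16,
      holds_grantedOut (A := A) hG hB e5 e6 e18 e19 e9 e11 (by decide) (by decide) e15,
      holds_grantedOut (A := A) hG hB e5 e6 e18 e19 e9 e11 (by decide) (by decide) e17]

/-- The literal `9` implies the literal `10`. -/
def implies (inA inB : ℕ → Expr) : Expr :=
  and (lt (var 9) (add verts verts)) (sum 11 (and (isNeg 10 11) (forbids inA inB)))

theorem holds_implies (hG : Encodes G L w) (hA : Defines L w u inA A) (hB : Defines L w u inB B)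
    (h5 : v 5 = a) (h6 : v 6 = b) (h18 : v 18 = u 18) (h19 : v 19 = u 19) (i j : ℕ) :
    Holds L w (implies inA inB) (Function.update (Function.update v 9 i) 10 j) ↔
      ∃ l m, i = litCode l ∧ j = litCode m ∧ TwoSat.Implies (G.Forbids A B a b) l m := by
  simp only [implies, holds_and, holds_lt, holds_sum, holds_isNeg hG, eval, eval_verts hG]
  have hforb : ∀ l m : Fin n × Bool, Holds L w (forbids inA inB) (Function.update
      (Function.update (Function.update v 9 (litCode l)) 10 j) 11 (litCode m)) ↔
      G.Forbids A B a b l m := fun l m => holds_forbids hG hA hB (by simp [h5]) (by simp [h6])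
    (by simp [h18]) (by simp [h19]) (by simp) (by simp)
  constructor
  -- The bound on variable `9` makes it the code of a literal; for `10` and `11` this follows from
  -- `isNeg`.
  · rintro ⟨h1, k, hk, ⟨m, hm, hm'⟩, hf⟩
    obtain ⟨l, rfl⟩ := lt_iff_exists_litCode.mp (by simpa using h1 : i < n + n)
    obtain rfl : j = litCode m := by simpa using hm
    obtain rfl : k = litCode (TwoSat.neg m) := by simpa using hm'
    exact ⟨l, m, rfl, rfl, (hforb _ _).mp hf⟩
  · rintro ⟨l, m, rfl, rfl, hf⟩
    refine ⟨by simpa using litCode_lt l, litCode (TwoSat.neg m),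
      (litCode_lt _).trans_le hG.two_mul_le, ⟨m, by simp, by simp⟩, (hforb _ _).mpr hf⟩

/-- The literal `x` implies the literal `y` by a chain of implications. -/
def chain (inA inB : ℕ → Expr) (x y : ℕ) : Expr :=
  reach 9 (eq (var 9) (var x)) (implies inA inB) (eq (var 9) (var y))

theorem holds_chain (hG : Encodes G L w) (hA : Defines L w u inA A) (hB : Defines L w u inB B)
    (h5 : v 5 = a) (h6 : v 6 = b) (h18 : v 18 = u 18) (h19 : v 19 = u 19) {x y : ℕ} (hx : x ≠ 9)
    (hy : y ≠ 9) {l m : Fin n × Bool} (hl : v x = litCode l) (hm : v y = litCode m) :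
    Holds L w (chain inA inB x y) v ↔
      Relation.ReflTransGen (TwoSat.Implies (G.Forbids A B a b)) l m := by
  refine holds_reach litCode_injective (fun l => (litCode_lt l).trans_le hG.two_mul_le) ?_
    (holds_implies hG hA hB h5 h6 h18 h19) ?_
  · simp [eval, hx, hl]
  · simp [eval, hy, hm]

/-- Some literal implies its negation and conversely. -/
def conflict (inA inB : ℕ → Expr) : Expr :=
  sum 12 <| sum 13 <| and (isNeg 12 13) <| and (chain inA inB 12 13) (chain inA inB 13 12)

theorem holds_conflict (hG : Encodes G L w) (hA : Defines L w u inA A) (hB : Defines L w u inB B)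
    (h5 : v 5 = a) (h6 : v 6 = b) (h18 : v 18 = u 18) (h19 : v 19 = u 19) :
    Holds L w (conflict inA inB) v ↔
      ∃ l, Relation.ReflTransGen (TwoSat.Implies (G.Forbids A B a b)) l (TwoSat.neg l) ∧
        Relation.ReflTransGen (TwoSat.Implies (G.Forbids A B a b)) (TwoSat.neg l) l := by
  simp only [conflict, holds_sum, holds_and, holds_isNeg hG]
  have key : ∀ l : Fin n × Bool, ∀ v', v' = Function.update (Function.update v 12 (litCode l)) 13
      (litCode (TwoSat.neg l)) →
      (Holds L w (chain inA inB 12 13) v' ∧ Holds L w (chain inA inB 13 12) v' ↔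
      Relation.ReflTransGen (TwoSat.Implies (G.Forbids A B a b)) l (TwoSat.neg l) ∧
        Relation.ReflTransGen (TwoSat.Implies (G.Forbids A B a b)) (TwoSat.neg l) l) := by
    rintro l v' hv'
    have e5 : v' 5 = a := by simp [hv', h5]
    have e6 : v' 6 = b := by simp [hv', h6]
    have e18 : v' 18 = u 18 := by simp [hv', h18]
    have e19 : v' 19 = u 19 := by simp [hv', h19]
    have e12 : v' 12 = litCode l := by simp [hv']
    have e13 : v' 13 = litCode (TwoSat.neg l) := by simp [hv']
    rw [holds_chain hG hA hB e5 e6 e18 e19 (by decide) (by decide) e12 e13,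
      holds_chain hG hA hB e5 e6 e18 e19 (by decide) (by decide) e13 e12]
  constructor
  · rintro ⟨i, hi, j, hj, ⟨l, hl, hl'⟩, h⟩
    obtain rfl : i = litCode l := by simpa using hl
    obtain rfl : j = litCode (TwoSat.neg l) := by simpa using hl'
    exact ⟨l, (key l _ rfl).mp h⟩
  · rintro ⟨l, h⟩
    exact ⟨litCode l, (litCode_lt l).trans_le hG.two_mul_le, litCode (TwoSat.neg l),
      (litCode_lt _).trans_le hG.two_mul_le, ⟨l, by simp, by simp⟩, (key l _ rfl).mpr h⟩

/-- The sets defined by `inA` and `inB` are separable. -/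
def separable (inA inB : ℕ → Expr) : Expr :=
  not <| exV 3 <| exV 4 <| and (inA 3) <| and (inB 4) <| and (conn 3 4) <| not <|
    exV 5 <| exV 6 <| and (adj 5 6) <| and (conn 3 5) <| not (conflict inA inB)

theorem holds_separable (hG : Encodes G L w) (hA : Defines L w u inA A)
    (hB : Defines L w u inB B) (h18 : v 18 = u 18) (h19 : v 19 = u 19) :
    Holds L w (separable inA inB) v ↔ G.MonoSeparable A B := by
  rw [SimpleGraph.monoSeparable_iff]
  simp only [separable, holds_not, holds_exV hG, holds_and]
  have hs : ∀ s t : Fin n, ∀ v', v' = Function.update (Function.update v 3 (s : ℕ)) 4 (t : ℕ) →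
      (Holds L w (inA 3) v' ↔ s ∈ A) ∧ (Holds L w (inB 4) v' ↔ t ∈ B) ∧
        (Holds L w (conn 3 4) v' ↔ G.Reachable s t) := by
    intro s t v' hv'
    have e3 : v' 3 = s := by simp [hv']
    have e4 : v' 4 = t := by simp [hv']
    have e18 : v' 18 = u 18 := by simp [hv', h18]
    have e19 : v' 19 = u 19 := by simp [hv', h19]
    exact ⟨hA v' e18 e19 3 (by decide) s e3, hB v' e18 e19 4 (by decide) t e4,
      holds_conn hG (by decide) (by decide) e3 e4⟩
  have ha : ∀ s t a b : Fin n, ∀ v', v' = Function.update (Function.update (Function.update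
      (Function.update v 3 (s : ℕ)) 4 (t : ℕ)) 5 (a : ℕ)) 6 (b : ℕ) →
      (Holds L w (adj 5 6) v' ↔ G.Adj a b) ∧ (Holds L w (conn 3 5) v' ↔ G.Reachable s a) ∧
      (Holds L w (conflict inA inB) v' ↔
        ∃ l, Relation.ReflTransGen (TwoSat.Implies (G.Forbids A B a b)) l (TwoSat.neg l) ∧
          Relation.ReflTransGen (TwoSat.Implies (G.Forbids A B a b)) (TwoSat.neg l) l) := by
    intro s t a b v' hv'
    have e3 : v' 3 = s := by simp [hv']
    have e5 : v' 5 = a := by simp [hv']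
    have e6 : v' 6 = b := by simp [hv']
    have e18 : v' 18 = u 18 := by simp [hv', h18]
    have e19 : v' 19 = u 19 := by simp [hv', h19]
    exact ⟨holds_adj hG (by decide) e5 e6, holds_conn hG (by decide) (by decide) e3 e5,
      holds_conflict hG hA hB e5 e6 e18 e19⟩
  simp only [(hs _ _ _ rfl).1, (hs _ _ _ rfl).2.1, (hs _ _ _ rfl).2.2, (ha _ _ _ _ _ rfl).1,
    (ha _ _ _ _ _ rfl).2.1, (ha _ _ _ _ _ rfl).2.2]
  constructor
  · intro h s hsA t htB hst
    by_contra hcon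
    exact h ⟨s, t, hsA, htB, hst, hcon⟩
  · rintro h ⟨s, t, hsA, htB, hst, hcon⟩
    exact hcon (h s hsA t htB hst)

end Expr

end RAM

/-! ### Decoding the inputs -/

/-- All blocks have length `n`, so position `i * n + j` is entry `j` of block `i`. -/
theorem List.getD_flatMap {α β : Type*} {f : α → List β} {n : ℕ} (hf : ∀ a, (f a).length = n)
    (l : List α) (i : ℕ) (hi : i < l.length) (j : ℕ) (hj : j < n) (d : β) :
    (l.flatMap f).getD (i * n + j) d = (f l[i]).getD j d := by
  induction l generalizing i with
  | nil => simp at hi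
  | cons a l ih =>
    cases i with
    | zero =>
      rw [List.flatMap_cons, List.getD_append _ _ _ _ (by rw [hf]; omega)]
      simp
    | succ i =>
      have hlen : (f a).length ≤ (i + 1) * n + j := by
        rw [hf, Nat.succ_mul]
        omega
      rw [List.flatMap_cons, List.getD_append_right _ _ _ _ hlen, hf,
        show (i + 1) * n + j - n = i * n + j by rw [Nat.succ_mul]; omega,
        ih i (by simpa using hi)]
      simp

theorem length_encodeVertexSet {n : ℕ} (X : Set (Fin n)) : (encodeVertexSet X).length = n := by
  simp [encodeVertexSet]

theorem getD_encodeVertexSet {n : ℕ} (X : Set (Fin n)) (i : Fin n) :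
    ((encodeVertexSet X).getD i false).toNat ≠ 0 ↔ i ∈ X := by
  simp [encodeVertexSet, List.getD_eq_getElem?_getD]

theorem GraphInput.length_encode (I : GraphInput) : I.encode.length = I.n + 1 + I.n * I.n := by
  simp [GraphInput.encode, length_encodeVertexSet]
  omega

/-- The arbitrary suffix covers both input formats: a graph alone and a graph followed by two vertex
sets. -/
theorem GraphInput.encodes_append (I : GraphInput) (l : List Bool) :
    RAM.Encodes I.graph (I.encode ++ l).length
      fun a => ((I.encode ++ l).getD a false).toNat := by
  have hlen := I.length_encode
  -- Together with the unary part this yields `2 * n ≤ L`, so that all literals can be numbered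
  -- below the input length.
  have hle : I.n ≤ I.n * I.n := Nat.le_mul_self _
  have hij : ∀ i j : Fin I.n, I.n + 1 + (i * I.n + j) < I.encode.length := fun i j => by
    have : ((i : ℕ) + 1) * I.n ≤ I.n * I.n := Nat.mul_le_mul_right _ i.2
    rw [Nat.succ_mul] at this
    omega
  have happ : ∀ a < I.encode.length, (I.encode ++ l).getD a false = I.encode.getD a false :=
    fun a ha => List.getD_append _ _ _ _ ha
  constructor
  · intro i hi
    rw [happ i (by omega), GraphInput.encode, List.append_assoc,
      List.getD_append _ _ _ _ (by simpa using hi)]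
    simp [hi]
  · rw [happ _ (by omega), GraphInput.encode, List.append_assoc,
      List.getD_append_right _ _ _ _ (by simp)]
    simp
  · rw [List.length_append]
    omega
  · rw [List.length_append]
    omega
  · intro i j
    rw [List.length_append]
    have := hij i j
    omega
  · intro i j
    rw [happ _ (hij i j), GraphInput.encode, List.getD_append_right _ _ _ _ (by simp)]
    have := List.getD_flatMap (fun i => length_encodeVertexSet (I.graph.neighborSet i))
      (List.finRange I.n) i (by simp) j j.2 false
    simp only [List.length_append, List.length_replicate, List.length_singleton,
      Nat.add_sub_cancel_left]
    rw [this, getD_encodeVertexSet]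
    simp

namespace SeparationInput

variable (I : SeparationInput)

/-- The letters of an encoded separation problem. -/
noncomputable def letter (a : ℕ) : ℕ := (I.encode.getD a false).toNat

theorem length_encode :
    I.encode.length = I.n + 1 + I.n * I.n + I.n + I.n := by
  simp [encode, GraphInput.length_encode, length_encodeVertexSet]
  omega

theorem encodes : RAM.Encodes I.graph I.encode.length I.letter := by
  have := I.toGraphInput.encodes_append (encodeVertexSet I.A ++ encodeVertexSet I.B)
  rw [← List.append_assoc] at this
  exact this

theorem letter_left (i : Fin I.n) : I.letter (I.n + 1 + I.n * I.n + i) ≠ 0 ↔ i ∈ I.A := by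
  have hlen := I.toGraphInput.length_encode
  rw [letter, encode, List.getD_append _ _ _ _ (by simp [hlen, length_encodeVertexSet]),
    List.getD_append_right _ _ _ _ (by omega), hlen, Nat.add_sub_cancel_left,
    getD_encodeVertexSet]

theorem letter_right (i : Fin I.n) :
    I.letter (I.n + 1 + I.n * I.n + I.n + i) ≠ 0 ↔ i ∈ I.B := by
  have hlen := I.toGraphInput.length_encode
  rw [letter, encode, List.getD_append_right _ _ _ _ (by
      rw [List.length_append, hlen, length_encodeVertexSet]; omega), List.length_append, hlen,
    length_encodeVertexSet, Nat.add_sub_cancel_left, getD_encodeVertexSet]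

end SeparationInput

/-! ### The formulas of the two decision problems -/

namespace RAM.Expr

/-- The length of the encoding of a graph. -/
def graphLen : Expr := add (add verts (const 1)) (mul verts verts)

theorem eval_graphLen {n L : ℕ} {G : SimpleGraph (Fin n)} {w : ℕ → ℕ} (hG : Encodes G L w)
    (v : ℕ → ℕ) : graphLen.eval L w v = n + 1 + n * n := by
  have := eval_mul (v := v) (fun k => eval_verts hG _) (fun k => eval_verts hG _) hG.lt.le
  rw [graphLen, eval, this]
  simp [eval, eval_verts hG]

/-- Membership in the first vertex set after a graph. -/
def leftSet (z : ℕ) : Expr := inp (add graphLen (var z))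

/-- Membership in the second vertex set after a graph. -/
def rightSet (z : ℕ) : Expr := inp (add (add graphLen verts) (var z))

variable (I : SeparationInput) (u : ℕ → ℕ)

theorem defines_leftSet : Defines I.encode.length I.letter u leftSet I.A := by
  intro v _ _ z _ k hz
  simp only [Holds, leftSet, eval, eval_graphLen I.encodes, hz]
  rw [if_pos (by rw [I.length_encode]; omega), I.letter_left]

theorem defines_rightSet : Defines I.encode.length I.letter u rightSet I.B := by
  intro v _ _ z _ k hz
  simp only [Holds, rightSet, eval, eval_graphLen I.encodes, eval_verts I.encodes, hz]
  rw [if_pos (by rw [I.length_encode]; omega), I.letter_right]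

/-- The two vertices to be separated are kept in variables `18` and `19`; this is why `Defines`
fixes the values of exactly these. -/
theorem defines_singleton {n L : ℕ} {w u : ℕ → ℕ} {x : ℕ} (hx : x = 18 ∨ x = 19) {s : Fin n}
    (hs : u x = s) : Defines L w u (fun z => eq (var z) (var x)) {s} := by
  intro v h18 h19 z _ k hz
  have hv : v x = s := by
    rcases hx with rfl | rfl
    · rw [h18, hs]
    · rw [h19, hs]
  simp [eval, hz, hv, Fin.val_inj]

/-- The graph has a partition into two convex sets. -/
def twoPartition : Expr :=
  exV 18 <| exV 19 <| separable (fun z => eq (var z) (var 18)) (fun z => eq (var z) (var 19))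

theorem holds_twoPartition {n L : ℕ} {G : SimpleGraph (Fin n)} {w : ℕ → ℕ} (hG : Encodes G L w)
    (v : ℕ → ℕ) : Holds L w twoPartition v ↔ G.HasMonoTwoPartition := by
  rw [SimpleGraph.hasMonoTwoPartition_iff, twoPartition, holds_exV hG]
  refine exists_congr fun s => ?_
  rw [holds_exV hG]
  refine exists_congr fun t => ?_
  exact holds_separable hG (defines_singleton (Or.inl rfl) (by simp))
    (defines_singleton (Or.inr rfl) (by simp)) rfl rfl

end RAM.Expr

theorem theorem1 :
    DecidableInPolyTime SeparationInput.encode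
        (fun I : SeparationInput => I.graph.MonoSeparable I.A I.B) ∧
      DecidableInPolyTime GraphInput.encode
        (fun I : GraphInput => I.graph.HasMonoTwoPartition) := by
  constructor
  · refine decidableInPolyTime_of_expr
      (RAM.Expr.separable RAM.Expr.leftSet RAM.Expr.rightSet) fun I => ?_
    exact RAM.Expr.holds_separable (u := fun _ => 0) I.encodes (RAM.Expr.defines_leftSet I _)
      (RAM.Expr.defines_rightSet I _) rfl rfl
  · refine decidableInPolyTime_of_expr RAM.Expr.twoPartition fun I => ?_
    have hI := I.encodes_append []
    rw [List.append_nil] at hI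
    exact RAM.Expr.holds_twoPartition hI _
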